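/- **Theorem (the solution stays graphical as long as it exists).** Let $(M^n,\sigma)$ be a smooth closed (compact, without boundary) Riemannian manifold with positive Ricci curvature, $\mathrm{Ric}_M(v,v)>0$ for all tangent vectors $v\neq 0$. Let $N^{n+1}=\mathbb R_+\times_{\mathrm{Id}}M^n$ be the warped product $(0,\infty)\times M$ with the metric $\gamma=dr^2\oplus r^2\sigma$. Let $u_0:M\to\mathbb R_+$ be of class $C^{2}$ (in particular, of class $C^{2,\alpha}$), and assume that its graph, embedded by $x_0(p)=(u_0(p),p)$, has positive mean curvature with respect to the outward unit normal. Let $0<T\le\infty$ and let $x:[0,T)\times M\to N$ be a solution of the inverse mean curvature flow $$\dot x=H^{-1}\nu,\qquad x(0,\cdot)=x_0 ,$$ that is: $x$ is smooth on $(0,T)\times M$; $x$ and its first space derivatives are continuous on $[0,T)\times M$; every $x(t,\cdot)$ is an immersion; $\nu$ is its outward unit normal (the unit normal field, continuous in $(t,p)$, which at $t=0$ satisfies $\gamma(\partial_r,\nu)>0$); $H$ is the mean curvature of $x(t,\cdot)$ with respect to $\nu$ (with the sign for which the slices $\{r\}\times M$ have $H=n/r$) and is nowhere zero; and the equation holds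 at all $t\in[0,T)$, with a one-sided time derivative at $t=0$. Write $M_t=x(t,M)$. Then: 1. For every $t\in[0,T)$ the hypersurface $M_t$ is a graph over $M$: there is a positive function $u(t,\cdot)\in C^2(M)$ with $M_t=\{(u(t,p),p): p\in M\}$. 2. With $X=r\,\partial/\partial r$, the inverse support function $\chi=\gamma(X,\nu)^{-1}$ is positive and bounded on compact time intervals: for every $T'\in[0,T)$ there is a constant $C$ with $0<\chi\le C$ on $[0,T']\times M$. -/

import Mathlib

open Set
open scoped Manifold ContDiff

noncomputable section

namespace IMCF

/-! ### Riemannian geometry in coordinates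

`G z` is the inner product at the point `z` of (an open subset of) the coordinate space `E`. -/

section Coordinates

variable {E : Type*} [NormedAddCommGroup E] [NormedSpace ℝ E]

/-- The Levi-Civita connection of `G` in coordinates: `christoffel G z v w` is the vector
`Γ(v, w)` at `z` with
`G(Γ(v, w), ξ) = (∂_v G(w, ξ) + ∂_w G(v, ξ) - ∂_ξ G(v, w)) / 2` for all `ξ`. Here
`(G z).inverse` raises the index. -/
def christoffel (G : E → E →L[ℝ] E →L[ℝ] ℝ) (z v w : E) : E :=
  (G z).inverse ((1 / 2 : ℝ) •
    (fderiv ℝ G z v w + fderiv ℝ G z w v - ((fderiv ℝ G z).flip v).flip w))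

/-- The Riemann curvature tensor `R(u, v) w = ∇_u ∇_v w - ∇_v ∇_u w` (for constant coordinate
fields `u`, `v`, `w`) of the Levi-Civita connection of `G`. -/
def curvature (G : E → E →L[ℝ] E →L[ℝ] ℝ) (z u v w : E) : E :=
  fderiv ℝ (fun y => christoffel G y v w) z u - fderiv ℝ (fun y => christoffel G y u w) z v
    + christoffel G z u (christoffel G z v w) - christoffel G z v (christoffel G z u w)

/-- The Ricci tensor `Ric(v, w) = tr (u ↦ R(u, v) w)`; it is positive on round spheres. -/
def ricci {n : ℕ} (G : EuclideanSpace ℝ (Fin n) →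
      EuclideanSpace ℝ (Fin n) →L[ℝ] EuclideanSpace ℝ (Fin n) →L[ℝ] ℝ)
    (z v w : EuclideanSpace ℝ (Fin n)) : ℝ :=
  ∑ i, curvature G z (EuclideanSpace.single i 1) v w i

end Coordinates

/-! ### Metrics on manifolds, Ricci curvature, hypersurfaces -/

section Manifolds

variable {E : Type*} [NormedAddCommGroup E] [NormedSpace ℝ E]
  {H : Type*} [TopologicalSpace H] (I : ModelWithCorners ℝ E H)
  {N : Type*} [TopologicalSpace N] [ChartedSpace H N]

/-- The coordinate expression, in the preferred chart at `p`, of a field `g` of bilinear forms on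
the tangent spaces. -/
def chartMetric (g : ∀ q : N, TangentSpace I q →L[ℝ] TangentSpace I q →L[ℝ] ℝ) (p : N) (z : E) :
    E →L[ℝ] E →L[ℝ] ℝ :=
  let A : E →L[ℝ] E := mfderiv 𝓘(ℝ, E) I (extChartAt I p).symm z
  let B : E →L[ℝ] E →L[ℝ] ℝ := g ((extChartAt I p).symm z)
  B.bilinearComp A A

variable {n : ℕ} {M : Type*} [TopologicalSpace M] [ChartedSpace (EuclideanSpace ℝ (Fin n)) M]

/-- The quadratic form `Ric(v) = Ric(v, v)` of the Ricci tensor of the metric `g` on `M`. -/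
def ricciForm (g : ∀ q : M, TangentSpace (𝓡 n) q →L[ℝ] TangentSpace (𝓡 n) q →L[ℝ] ℝ)
    (p : M) (v : TangentSpace (𝓡 n) p) : ℝ :=
  let v' : EuclideanSpace ℝ (Fin n) :=
    mfderiv (𝓡 n) 𝓘(ℝ, EuclideanSpace ℝ (Fin n)) (extChartAt (𝓡 n) p) p v
  ricci (chartMetric (𝓡 n) g p) (extChartAt (𝓡 n) p p) v' v'

/-- The coefficients, in the preferred chart at `p`, of the metric induced on `M` by an immersion
`f : M → N` into a manifold with metric `γ`: `g(v, w) = γ(∂_v f, ∂_w f)`. -/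
def inducedMetric (γ : ∀ q : N, TangentSpace I q →L[ℝ] TangentSpace I q →L[ℝ] ℝ)
    (f : M → N) (p : M) (v w : EuclideanSpace ℝ (Fin n)) : ℝ :=
  let F : EuclideanSpace ℝ (Fin n) → E := writtenInExtChartAt (𝓡 n) I p f
  let y := extChartAt (𝓡 n) p p
  chartMetric I γ (f p) (F y) (fderiv ℝ F y v) (fderiv ℝ F y w)

/-- The second fundamental form of an immersion `f : M → N` with respect to the unit normal `ν`,
in the preferred chart at `p`: `h(v, w) = -γ(∂_v ∂_w f + Γ(∂_v f, ∂_w f), ν)`, where `Γ` are the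
Christoffel symbols of `γ`. -/
def secondFundamentalForm (γ : ∀ q : N, TangentSpace I q →L[ℝ] TangentSpace I q →L[ℝ] ℝ)
    (f : M → N) (ν : ∀ p : M, TangentSpace I (f p)) (p : M) (v w : EuclideanSpace ℝ (Fin n)) : ℝ :=
  let F : EuclideanSpace ℝ (Fin n) → E := writtenInExtChartAt (𝓡 n) I p f
  let y := extChartAt (𝓡 n) p p
  let G := chartMetric I γ (f p)
  let ν' : E := mfderiv I 𝓘(ℝ, E) (extChartAt I (f p)) (f p) (ν p)
  let a : E := fderiv ℝ (fderiv ℝ F) y v w + christoffel G (F y) (fderiv ℝ F y v) (fderiv ℝ F y w)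
  (-(G (F y) a ν'))

/-- The mean curvature `H = g^{ij} h_{ij}`. -/
def meanCurvature (γ : ∀ q : N, TangentSpace I q →L[ℝ] TangentSpace I q →L[ℝ] ℝ)
    (f : M → N) (ν : ∀ p : M, TangentSpace I (f p)) (p : M) : ℝ :=
  let e : Fin n → EuclideanSpace ℝ (Fin n) := fun i => EuclideanSpace.single i 1
  let g : Matrix (Fin n) (Fin n) ℝ := Matrix.of fun i j => inducedMetric I γ f p (e i) (e j)
  let h : Matrix (Fin n) (Fin n) ℝ :=
    Matrix.of fun i j => secondFundamentalForm I γ f ν p (e i) (e j)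
  (g⁻¹ * h).trace

end Manifolds

/-! ### The warped product and the inverse mean curvature flow -/

section Flow

variable {n : ℕ} {M : Type*} [TopologicalSpace M] [ChartedSpace (EuclideanSpace ℝ (Fin n)) M]

/-- The model with corners of `ℝ × M`. The warped product `ℝ₊ ×_Id M` is the open subset
`{r > 0}` of `ℝ × M`. -/
abbrev coneModel (n : ℕ) : ModelWithCorners ℝ (ℝ × EuclideanSpace ℝ (Fin n))
    (ModelProd ℝ (EuclideanSpace ℝ (Fin n))) :=
  𝓘(ℝ, ℝ).prod (𝓡 n)

/-- The warped product metric `γ = dr² ⊕ r² σ`. -/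
def warpedMetric (σ : ∀ q : M, TangentSpace (𝓡 n) q →L[ℝ] TangentSpace (𝓡 n) q →L[ℝ] ℝ)
    (x : ℝ × M) :
    TangentSpace (coneModel n) x →L[ℝ] TangentSpace (coneModel n) x →L[ℝ] ℝ :=
  let B : EuclideanSpace ℝ (Fin n) →L[ℝ] EuclideanSpace ℝ (Fin n) →L[ℝ] ℝ := σ x.2
  let π₁ := ContinuousLinearMap.fst ℝ ℝ (EuclideanSpace ℝ (Fin n))
  let π₂ := ContinuousLinearMap.snd ℝ ℝ (EuclideanSpace ℝ (Fin n))
  ((ContinuousLinearMap.mul ℝ ℝ).bilinearComp π₁ π₁ + x.1 ^ 2 • B.bilinearComp π₂ π₂ :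
    (ℝ × EuclideanSpace ℝ (Fin n)) →L[ℝ] (ℝ × EuclideanSpace ℝ (Fin n)) →L[ℝ] ℝ)

/-- The radial unit vector field `∂/∂r` on `ℝ × M`. -/
def radialField (x : ℝ × M) : TangentSpace (coneModel n) x :=
  ((1, 0) : ℝ × EuclideanSpace ℝ (Fin n))

/-- The function `χ = γ(X, ν)⁻¹`, with `X = r ∂/∂r`, for the normal vector `ν` at `x`. -/
def chi (σ : ∀ q : M, TangentSpace (𝓡 n) q →L[ℝ] TangentSpace (𝓡 n) q →L[ℝ] ℝ)
    (x : ℝ × M) (ν : TangentSpace (coneModel n) x) : ℝ :=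
  (warpedMetric σ x (x.1 • radialField x) ν)⁻¹

/-- The time interval `[0, T)`, with `T = ∞` allowed. -/
def timeInterval (T : EReal) : Set ℝ := {t | 0 ≤ t ∧ (t : EReal) < T}

/-- `x : [0, T) × M → ℝ₊ ×_Id M` is a solution of the inverse mean curvature flow
`∂x/∂t = H⁻¹ ν` starting from the graph of `u₀`, and `ν t` is the outward unit normal to the
immersed hypersurface `x t`. Values at times outside `[0, T)` are irrelevant. -/
structure IsSolution [IsManifold (𝓡 n) ∞ M]
    (σ : ∀ q : M, TangentSpace (𝓡 n) q →L[ℝ] TangentSpace (𝓡 n) q →L[ℝ] ℝ)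
    (T : EReal) (u₀ : M → ℝ) (x : ℝ → M → ℝ × M)
    (ν : ∀ (t : ℝ) (p : M), TangentSpace (coneModel n) (x t p)) : Prop where
  /-- The initial hypersurface is the graph of `u₀`. -/
  initial : ∀ p, x 0 p = (u₀ p, p)
  /-- The flow takes place in the warped product `{r > 0}`. -/
  radius_pos : ∀ t ∈ timeInterval T, ∀ p, 0 < (x t p).1
  /-- The solution is smooth for positive times. -/
  smooth : ContMDiffOn (𝓘(ℝ, ℝ).prod (𝓡 n)) (coneModel n) ∞ (fun z : ℝ × M => x z.1 z.2)
    {z | z.1 ∈ timeInterval T ∧ 0 < z.1}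
  /-- The solution and its first space derivatives are continuous up to the initial time. -/
  continuous_tangentMap : ContinuousOn
    (fun z : ℝ × TangentBundle (𝓡 n) M => tangentMap (𝓡 n) (coneModel n) (x z.1) z.2)
    (timeInterval T ×ˢ univ)
  /-- Each `x t` is an immersion. -/
  immersion : ∀ t ∈ timeInterval T, ∀ p,
    Function.Injective (mfderiv (𝓡 n) (coneModel n) (x t) p)
  /-- `ν` has unit length. -/
  normal_unit : ∀ t ∈ timeInterval T, ∀ p, warpedMetric σ (x t p) (ν t p) (ν t p) = 1
  /-- `ν` is normal to the hypersurface. -/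
  normal_orthogonal : ∀ t ∈ timeInterval T, ∀ (p : M) (v : TangentSpace (𝓡 n) p),
    warpedMetric σ (x t p) (mfderiv (𝓡 n) (coneModel n) (x t) p v) (ν t p) = 0
  /-- `ν` depends continuously on time and space. -/
  normal_continuous : ContinuousOn
    (fun z : ℝ × M => (⟨x z.1 z.2, ν z.1 z.2⟩ : TangentBundle (coneModel n) (ℝ × M)))
    (timeInterval T ×ˢ univ)
  /-- `ν` points outward along the initial graph; by continuity this fixes `ν` at all times. -/
  normal_outward : ∀ p, 0 < warpedMetric σ (x 0 p) (radialField (x 0 p)) (ν 0 p)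
  /-- The mean curvature does not vanish, so that the right-hand side of the flow makes sense. -/
  meanCurvature_ne_zero : ∀ t ∈ timeInterval T, ∀ p,
    meanCurvature (n := n) (coneModel n) (warpedMetric σ) (x t) (ν t) p ≠ 0
  /-- The flow equation (with a one-sided time derivative at `t = 0`). -/
  flow : ∀ t ∈ timeInterval T, ∀ p,
    HasMFDerivWithinAt 𝓘(ℝ, ℝ) (coneModel n) (fun s => x s p) (timeInterval T) t
      (ContinuousLinearMap.toSpanSingleton ℝ
        ((meanCurvature (n := n) (coneModel n) (warpedMetric σ) (x t) (ν t) p)⁻¹ • ν t p))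

end Flow

end IMCF

end

/-!
The hypersurface `x t` is a radial graph as long as the radial component `ν.1 = γ(∂_r, ν)` of its
normal is positive, and `χ = (r * ν.1)⁻¹`. Everything therefore follows from the positivity of `ν.1`
on `[0, T) × M` (`IsSolution.normal_fst_pos`): `exists_graph` and `exists_chi_le` then give the graph
function and, by compactness, the bound on `χ`. The proof is by contradiction at the first time `b` at
which `ν.1` vanishes somewhere.

* **Graphs.** While `ν.1 > 0`, orthogonality of `ν` makes the radial projections `p ↦ (x t p).2`
  local diffeomorphisms, uniformly in time. At time `0` the projection is the identity, and a
  continuity argument in `t` shows that it stays bijective (`IsSolution.bijective_snd`). By the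
  inverse function theorem the logarithmic radius `φ = log r`, as a function on the base
  (`logRadius`), is `C²` in space and time (`IsSolution.contDiffAt_logRadius`).

* **Sign of `H`.** The radius satisfies `∂r/∂t = ν.1 / H`, with `H ≠ 0`. Derivatives have the
  intermediate value property, so `H` keeps the positive sign that it has at time `0`.

* **Speed.** For the graph of `r = exp φ` in the cone one has `H = (ν.1 / r) * tr` with the trace
  `tr` (`graphTrace`) of `σ + dφ ⊗ dφ - ∇²φ` with respect to `σ + dφ ⊗ dφ`, and
  `ν.1² * (1 + |dφ|²) = 1`. The flow equation becomes `∂φ/∂t * tr = 1 + |dφ|²` (`graph_speed`), with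
  `∂φ/∂t = (r * ν.1 * H)⁻¹ > 0`. The right-hand side does not contain `φ` itself, because homotheties
  of the cone preserve the flow. Hence two time translates of `φ` can be compared: at a maximum of
  `φ (t + τ) - φ t` the gradients agree and the Hessians are ordered, so that the traces, and with
  them the speeds, are ordered. The maximum of `φ (t + τ) - φ t` is thus non-increasing in `t`
  (`HasGraphSpeed.sub_le_of_sub_le`), and `τ → 0` gives an upper bound for `∂φ/∂t` on `[ε, b)`
  (`HasGraphSpeed.exists_deriv_le`).

* **Contradiction.** This bound reads `H⁻¹ ≤ C * r * ν.1`. At a point where `ν.1` tends to zero as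
  `t` increases to `b`, the velocity `H⁻¹ ν` tends to zero too. But the velocity is continuous at `b`
  and equal to `H⁻¹ ν ≠ 0` there (`IsSolution.normal_fst_ne_zero`).
-/

noncomputable section

namespace IMCF

open Filter Topology

/-! ### Traces of bilinear forms -/

section Trace

variable {n : ℕ}

/-- The matrix of a bilinear form on `ℝⁿ` in the standard basis. -/
def formMatrix (b : EuclideanSpace ℝ (Fin n) → EuclideanSpace ℝ (Fin n) → ℝ) :
    Matrix (Fin n) (Fin n) ℝ :=
  Matrix.of fun i j => b (EuclideanSpace.single i 1) (EuclideanSpace.single j 1)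

/-- The trace of the bilinear form `h` with respect to the inner product `g`. -/
def formTrace (g h : EuclideanSpace ℝ (Fin n) → EuclideanSpace ℝ (Fin n) → ℝ) : ℝ :=
  ((formMatrix g)⁻¹ * formMatrix h).trace

theorem sum_coord_smul_single (v : EuclideanSpace ℝ (Fin n)) :
    ∑ i, v i • EuclideanSpace.single i (1 : ℝ) = v := by
  ext j
  simp [Finset.sum_apply, Pi.single_apply]

theorem formMatrix_comp (b : EuclideanSpace ℝ (Fin n) →ₗ[ℝ] EuclideanSpace ℝ (Fin n) →ₗ[ℝ] ℝ)
    (B : EuclideanSpace ℝ (Fin n) →ₗ[ℝ] EuclideanSpace ℝ (Fin n)) :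
    formMatrix (fun v w => b (B v) (B w)) =
      (Matrix.of fun i j => B (EuclideanSpace.single j 1) i).transpose * formMatrix
        (fun v w => b v w) *
        (Matrix.of fun i j => B (EuclideanSpace.single j 1) i) := by
  ext i j
  rw [Matrix.mul_apply]
  simp only [Matrix.mul_apply, formMatrix, Matrix.of_apply, Matrix.transpose_apply]
  conv_lhs => rw [← sum_coord_smul_single (B (EuclideanSpace.single i 1)),
    ← sum_coord_smul_single (B (EuclideanSpace.single j 1))]
  simp only [map_sum, map_smul, LinearMap.sum_apply, LinearMap.smul_apply,
    smul_eq_mul, Finset.mul_sum, Finset.sum_mul]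
  refine Finset.sum_congr rfl fun k _ => Finset.sum_congr rfl fun l _ => ?_
  ring

/-- The trace does not change under a linear change of coordinates. -/
theorem formTrace_comp (g h : EuclideanSpace ℝ (Fin n) →ₗ[ℝ] EuclideanSpace ℝ (Fin n) →ₗ[ℝ] ℝ)
    (B : EuclideanSpace ℝ (Fin n) ≃ₗ[ℝ] EuclideanSpace ℝ (Fin n)) :
    formTrace (fun v w => g (B v) (B w)) (fun v w => h (B v) (B w)) =
      formTrace (fun v w => g v w) (fun v w => h v w) := by
  set Q : Matrix (Fin n) (Fin n) ℝ := Matrix.of fun i j => B (EuclideanSpace.single j 1) i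
  set R : Matrix (Fin n) (Fin n) ℝ := Matrix.of fun i j => B.symm (EuclideanSpace.single j 1) i
  have hQR : Q * R = 1 := by
    ext i j
    have : B (B.symm (EuclideanSpace.single j 1)) i = (EuclideanSpace.single j (1 : ℝ)) i := by simp
    rw [← sum_coord_smul_single (B.symm (EuclideanSpace.single j 1))] at this
    simp only [map_sum, map_smul, WithLp.ofLp_sum, Finset.sum_apply, WithLp.ofLp_smul,
      Pi.smul_apply, smul_eq_mul] at this
    rw [Matrix.mul_apply, Matrix.one_apply]
    simp only [Q, R, Matrix.of_apply]
    simp_rw [mul_comm (B _ i)]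
    rw [this]
    simp
  have hQ : IsUnit Q.det := by
    rw [← Matrix.isUnit_iff_isUnit_det]
    exact IsUnit.of_mul_eq_one _ hQR
  have hQt : IsUnit Q.transpose.det := by rwa [Matrix.det_transpose]
  unfold formTrace
  have e1 := formMatrix_comp g (B : EuclideanSpace ℝ (Fin n) →ₗ[ℝ] EuclideanSpace ℝ (Fin n))
  have e2 := formMatrix_comp h (B : EuclideanSpace ℝ (Fin n) →ₗ[ℝ] EuclideanSpace ℝ (Fin n))
  simp only [LinearEquiv.coe_coe] at e1 e2
  rw [e1, e2, Matrix.mul_inv_rev, Matrix.mul_inv_rev]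
  change (Q⁻¹ * ((formMatrix fun v w => g v w)⁻¹ * Q.transpose⁻¹) *
    (Q.transpose * (formMatrix fun v w => h v w) * Q)).trace = _
  have : Q⁻¹ * ((formMatrix fun v w => g v w)⁻¹ * Q.transpose⁻¹) *
      (Q.transpose * (formMatrix fun v w => h v w) * Q) =
      Q⁻¹ * ((formMatrix fun v w => g v w)⁻¹ * (Q.transpose⁻¹ * Q.transpose) *
        (formMatrix fun v w => h v w) * Q) := by
    simp only [Matrix.mul_assoc]
  rw [this, Matrix.nonsing_inv_mul _ hQt, Matrix.trace_mul_comm, Matrix.mul_one, Matrix.mul_assoc,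
    Matrix.mul_nonsing_inv _ hQ, Matrix.mul_one]

theorem formTrace_smul (g h : EuclideanSpace ℝ (Fin n) → EuclideanSpace ℝ (Fin n) → ℝ) (a b : ℝ)
    (ha : a ≠ 0) :
    formTrace (fun v w => a * g v w) (fun v w => b * h v w) = b / a * formTrace g h := by
  have e (c : ℝ) (k : EuclideanSpace ℝ (Fin n) → EuclideanSpace ℝ (Fin n) → ℝ) :
      formMatrix (fun v w => c * k v w) = c • formMatrix k := by
    ext i j; simp [formMatrix]
  unfold formTrace
  have hinv : (a • formMatrix g)⁻¹ = a⁻¹ • (formMatrix g)⁻¹ := by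
    by_cases h0 : IsUnit (formMatrix g).det
    · have := Matrix.inv_smul' (formMatrix g) (Units.mk0 a ha) h0
      simpa [Units.smul_def] using this
    · have h1 : ¬ IsUnit (a • formMatrix g).det := by
        rw [Matrix.det_smul]
        intro h
        exact h0 (isUnit_of_mul_isUnit_right h)
      rw [Matrix.nonsing_inv_apply_not_isUnit _ h0, Matrix.nonsing_inv_apply_not_isUnit _ h1,
        smul_zero]
  rw [e, e, hinv, Matrix.smul_mul, Matrix.mul_smul, Matrix.trace_smul, Matrix.trace_smul]
  simp only [smul_eq_mul]
  ring

theorem dotProduct_formMatrix_mulVec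
    (b : EuclideanSpace ℝ (Fin n) →ₗ[ℝ] EuclideanSpace ℝ (Fin n) →ₗ[ℝ] ℝ)
    (v : Fin n → ℝ) :
    v ⬝ᵥ Matrix.mulVec (formMatrix fun v w => b v w) v = b (WithLp.toLp 2 v) (WithLp.toLp 2 v) := by
  conv_rhs => rw [← sum_coord_smul_single (WithLp.toLp 2 v)]
  simp only [dotProduct, Matrix.mulVec, formMatrix, Matrix.of_apply, map_sum, map_smul,
    LinearMap.sum_apply, LinearMap.smul_apply, smul_eq_mul, Finset.mul_sum]
  rw [Finset.sum_comm]
  refine Finset.sum_congr rfl fun k _ => Finset.sum_congr rfl fun l _ => ?_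
  ring

open scoped MatrixOrder Matrix.Norms.L2Operator in
/-- The trace with respect to an inner product is monotone on symmetric forms. -/
theorem formTrace_mono (g h₁ h₂ : EuclideanSpace ℝ (Fin n) →ₗ[ℝ] EuclideanSpace ℝ (Fin n) →ₗ[ℝ] ℝ)
    (hgs : ∀ v w, g v w = g w v) (hg : ∀ v, v ≠ 0 → 0 < g v v)
    (hs : ∀ v w, h₂ v w - h₁ v w = h₂ w v - h₁ w v) (hle : ∀ v, h₁ v v ≤ h₂ v v) :
    formTrace (fun v w => g v w) (fun v w => h₁ v w) ≤
      formTrace (fun v w => g v w) (fun v w => h₂ v w) := by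
  have hG : (formMatrix fun v w => g v w).PosDef := by
    refine Matrix.PosDef.of_dotProduct_mulVec_pos ?_ fun v hv => ?_
    · ext i j; simp [formMatrix, hgs]
    · rw [star_trivial, dotProduct_formMatrix_mulVec]
      exact hg _ (by simpa using hv)
  have hD : (formMatrix fun v w => (h₂ - h₁) v w).PosSemidef := by
    refine Matrix.PosSemidef.of_dotProduct_mulVec_nonneg ?_ fun v => ?_
    · ext i j; simp [formMatrix, hs]
    · rw [star_trivial, dotProduct_formMatrix_mulVec]
      simpa using hle _
  have key : 0 ≤ ((formMatrix fun v w => g v w)⁻¹ * formMatrix fun v w => (h₂ - h₁) v w).trace := by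
    obtain ⟨B, hB⟩ := CStarAlgebra.nonneg_iff_eq_star_mul_self.mp hG.inv.posSemidef.nonneg
    rw [hB, Matrix.mul_assoc, Matrix.trace_mul_comm]
    exact (hD.mul_mul_conjTranspose_same B).trace_nonneg
  have e : (formMatrix fun v w => (h₂ - h₁) v w) =
      (formMatrix fun v w => h₂ v w) - formMatrix fun v w => h₁ v w := by
    ext i j; simp [formMatrix]
  rw [e, Matrix.mul_sub, Matrix.trace_sub] at key
  unfold formTrace
  linarith

end Trace

/-! ### Radial graphs in a cone, in coordinates -/

section Cone

variable {𝔼 : Type*} [NormedAddCommGroup 𝔼] [NormedSpace ℝ 𝔼]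

/-- The cone metric `dr² ⊕ r² S` over a coordinate metric `S`, at the point `(r, z)`. -/
def coneMetric (S : 𝔼 → 𝔼 →L[ℝ] 𝔼 →L[ℝ] ℝ) (z : ℝ × 𝔼) : (ℝ × 𝔼) →L[ℝ] (ℝ × 𝔼) →L[ℝ] ℝ :=
  (ContinuousLinearMap.mul ℝ ℝ).bilinearComp (.fst ℝ ℝ 𝔼) (.fst ℝ ℝ 𝔼) +
    z.1 ^ 2 • (S z.2).bilinearComp (.snd ℝ ℝ 𝔼) (.snd ℝ ℝ 𝔼)

@[simp]
theorem coneMetric_apply (S : 𝔼 → 𝔼 →L[ℝ] 𝔼 →L[ℝ] ℝ) (z a b : ℝ × 𝔼) :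
    coneMetric S z a b = a.1 * b.1 + z.1 ^ 2 * S z.2 a.2 b.2 := by
  simp [coneMetric]

/-- The Christoffel symbols of the first kind of the coordinate metric `S`. -/
def christoffelFirst (S : 𝔼 → 𝔼 →L[ℝ] 𝔼 →L[ℝ] ℝ) (z v w u : 𝔼) : ℝ :=
  (1 / 2) * (fderiv ℝ S z v w u + fderiv ℝ S z w v u - fderiv ℝ S z u v w)

theorem hasFDerivAt_const_add_smul_clm {V W W' : Type*} [NormedAddCommGroup V] [NormedSpace ℝ V]
    [NormedAddCommGroup W] [NormedSpace ℝ W] [NormedAddCommGroup W'] [NormedSpace ℝ W']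
    (C : W') (L : W →L[ℝ] W') {g : V → ℝ} {T : V → W} {g' : V →L[ℝ] ℝ} {T' : V →L[ℝ] W} {z : V}
    (hg : HasFDerivAt g g' z) (hT : HasFDerivAt T T' z) :
    HasFDerivAt (fun y => C + g y • L (T y)) (g z • L.comp T' + g'.smulRight (L (T z))) z :=
  (hg.smul (L.hasFDerivAt.comp z hT)).const_add C

theorem exists_clm_bilinearComp {V W : Type*} [NormedAddCommGroup V] [NormedSpace ℝ V]
    [NormedAddCommGroup W] [NormedSpace ℝ W] [FiniteDimensional ℝ W] (A : V →L[ℝ] W) :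
    ∃ L : (W →L[ℝ] W →L[ℝ] ℝ) →L[ℝ] (V →L[ℝ] V →L[ℝ] ℝ), ∀ B, L B = B.bilinearComp A A := by
  let L : (W →L[ℝ] W →L[ℝ] ℝ) →ₗ[ℝ] (V →L[ℝ] V →L[ℝ] ℝ) :=
    { toFun := fun B => B.bilinearComp A A
      map_add' := fun B C => by ext v w; simp
      map_smul' := fun r B => by ext v w; simp }
  exact ⟨LinearMap.toContinuousLinearMap (𝕜 := ℝ) (E := W →L[ℝ] W →L[ℝ] ℝ) (F' := V →L[ℝ] V →L[ℝ] ℝ)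
    L,
    fun B => by rw [LinearMap.coe_toContinuousLinearMap']; rfl⟩

theorem fderiv_coneMetric [FiniteDimensional ℝ 𝔼] {S : 𝔼 → 𝔼 →L[ℝ] 𝔼 →L[ℝ] ℝ} {z : ℝ × 𝔼}
    (hS : DifferentiableAt ℝ S z.2) (a b c : ℝ × 𝔼) :
    fderiv ℝ (coneMetric S) z a b c =
      2 * z.1 * a.1 * S z.2 b.2 c.2 + z.1 ^ 2 * fderiv ℝ S z.2 a.2 b.2 c.2 := by
  obtain ⟨L, hL⟩ := exists_clm_bilinearComp (ContinuousLinearMap.snd ℝ ℝ 𝔼)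
  have h2 : HasFDerivAt (fun y : ℝ × 𝔼 => S y.2) ((fderiv ℝ S z.2).comp (.snd ℝ ℝ 𝔼)) z :=
    HasFDerivAt.comp (g := S) (f := Prod.snd) z hS.hasFDerivAt
      (ContinuousLinearMap.snd ℝ ℝ 𝔼).hasFDerivAt
  have h1 : HasFDerivAt (fun y : ℝ × 𝔼 => y.1 ^ 2) ((2 * z.1) • ContinuousLinearMap.fst ℝ ℝ 𝔼) z :=
    by
    simpa using (hasFDerivAt_fst (𝕜 := ℝ) (p := z)).pow 2
  have h := hasFDerivAt_const_add_smul_clm (W := 𝔼 →L[ℝ] 𝔼 →L[ℝ] ℝ)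
    (W' := (ℝ × 𝔼) →L[ℝ] (ℝ × 𝔼) →L[ℝ] ℝ)
    ((ContinuousLinearMap.mul ℝ ℝ).bilinearComp (.fst ℝ ℝ 𝔼) (.fst ℝ ℝ 𝔼)) L h1 h2
  have e : coneMetric S = fun y => (ContinuousLinearMap.mul ℝ ℝ).bilinearComp (.fst ℝ ℝ 𝔼)
      (.fst ℝ ℝ 𝔼) + y.1 ^ 2 • L (S y.2) := by
    funext y
    rw [hL]
    rfl
  rw [e, h.fderiv]
  simp only [add_apply, smul_apply, ContinuousLinearMap.comp_apply,
    ContinuousLinearMap.smulRight_apply, hL, ContinuousLinearMap.bilinearComp_apply,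
    ContinuousLinearMap.coe_snd', ContinuousLinearMap.coe_fst', smul_eq_mul]
  ring

theorem apply_christoffel {E : Type*} [NormedAddCommGroup E] [NormedSpace ℝ E]
    (G : E → E →L[ℝ] E →L[ℝ] ℝ) {z : E} (hG : (G z).IsInvertible) (v w u : E) :
    G z (christoffel G z v w) u =
      1 / 2 * (fderiv ℝ G z v w u + fderiv ℝ G z w v u - fderiv ℝ G z u v w) := by
  unfold christoffel
  rw [hG.self_apply_inverse]
  simp

theorem isInvertible_of_apply_self_ne_zero {V : Type*} [NormedAddCommGroup V] [NormedSpace ℝ V]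
    [FiniteDimensional ℝ V] {B : V →L[ℝ] V →L[ℝ] ℝ} (hB : ∀ v, v ≠ 0 → B v v ≠ 0) :
    B.IsInvertible := by
  have hinj : Function.Injective (B : V →ₗ[ℝ] V →L[ℝ] ℝ) := by
    rw [← LinearMap.ker_eq_bot, LinearMap.ker_eq_bot']
    intro v hv
    by_contra h
    exact hB v h (by simpa using congrArg (fun f : V →L[ℝ] ℝ => f v) hv)
  have hrank : Module.finrank ℝ V = Module.finrank ℝ (V →L[ℝ] ℝ) := by
    rw [← (LinearMap.toContinuousLinearMap (𝕜 := ℝ) (E := V) (F' := ℝ)).finrank_eq]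
    exact (Subspace.dual_finrank_eq (K := ℝ) (V := V)).symm
  refine ⟨(LinearEquiv.ofInjectiveOfFinrankEq (B : V →ₗ[ℝ] V →L[ℝ] ℝ) hinj
    hrank).toContinuousLinearEquiv, ?_⟩
  ext v w
  rfl

/-- The derivative of a parametrized radial graph `y ↦ (exp (φ (P y)), P y)`. -/
theorem fderiv_graph {F : 𝔼 → ℝ × 𝔼} {P : 𝔼 → 𝔼} {φ : 𝔼 → ℝ} {y : 𝔼}
    (hP : DifferentiableAt ℝ P y) (hφ : DifferentiableAt ℝ φ (P y))
    (hF : F =ᶠ[𝓝 y] fun y => (Real.exp (φ (P y)), P y)) (w : 𝔼) :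
    fderiv ℝ F y w = (Real.exp (φ (P y)) * fderiv ℝ φ (P y) (fderiv ℝ P y w), fderiv ℝ P y w) := by
  have h := (((hφ.hasFDerivAt.comp y hP.hasFDerivAt).exp).prodMk hP.hasFDerivAt)
  rw [(h.congr_of_eventuallyEq hF).fderiv]
  simp

theorem fderiv_fderiv_graph {F : 𝔼 → ℝ × 𝔼} {P : 𝔼 → 𝔼} {φ : 𝔼 → ℝ} {y : 𝔼}
    (hP : ContDiffAt ℝ 2 P y) (hφ : ContDiffAt ℝ 2 φ (P y))
    (hF : F =ᶠ[𝓝 y] fun y => (Real.exp (φ (P y)), P y)) (v w : 𝔼) :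
    fderiv ℝ (fderiv ℝ F) y v w =
      (Real.exp (φ (P y)) *
        (fderiv ℝ φ (P y) (fderiv ℝ P y v) * fderiv ℝ φ (P y) (fderiv ℝ P y w) +
          fderiv ℝ (fderiv ℝ φ) (P y) (fderiv ℝ P y v) (fderiv ℝ P y w) +
          fderiv ℝ φ (P y) (fderiv ℝ (fderiv ℝ P) y v w)),
        fderiv ℝ (fderiv ℝ P) y v w) := by
  have hP1 : DifferentiableAt ℝ P y := hP.differentiableAt two_ne_zero
  have hφ1 : DifferentiableAt ℝ φ (P y) := hφ.differentiableAt two_ne_zero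
  have hP2 : DifferentiableAt ℝ (fderiv ℝ P) y :=
    (hP.fderiv_right (m := 1) (by norm_num)).differentiableAt one_ne_zero
  have hφ2 : DifferentiableAt ℝ (fderiv ℝ φ) (P y) :=
    (hφ.fderiv_right (m := 1) (by norm_num)).differentiableAt one_ne_zero
  have hgr : ContDiffAt ℝ 2 (fun y => (Real.exp (φ (P y)), P y)) y :=
    ((hφ.comp y hP).exp).prodMk hP
  have hF2 : DifferentiableAt ℝ (fderiv ℝ F) y :=
    ((hgr.congr_of_eventuallyEq hF).fderiv_right (m := 1) (by norm_num)).differentiableAt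
      one_ne_zero
  have e1 : fderiv ℝ (fderiv ℝ F) y v w = fderiv ℝ (fun z => fderiv ℝ F z w) y v := by
    rw [((hF2.hasFDerivAt).clm_apply (hasFDerivAt_const w y)).fderiv]
    simp
  have hPw : HasFDerivAt (fun z => fderiv ℝ P z w) ((fderiv ℝ (fderiv ℝ P) y).flip w) y := by
    have := (hP2.hasFDerivAt).clm_apply (hasFDerivAt_const w y)
    refine this.congr_fderiv ?_
    ext; simp
  have e2 : (fun z => fderiv ℝ F z w) =ᶠ[𝓝 y] fun z =>
      (Real.exp (φ (P z)) * fderiv ℝ φ (P z) (fderiv ℝ P z w), fderiv ℝ P z w) := by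
    have hPe : ∀ᶠ z in 𝓝 y, DifferentiableAt ℝ P z :=
      (hP.eventually (by simp)).mono fun z hz => hz.differentiableAt two_ne_zero
    have hφe : ∀ᶠ z in 𝓝 y, DifferentiableAt ℝ φ (P z) :=
      hP1.continuousAt.eventually
        ((hφ.eventually (by simp)).mono fun z hz => hz.differentiableAt two_ne_zero)
    filter_upwards [hPe, hφe, hF.eventually_nhds] with z h1 h2 h3
    exact fderiv_graph h1 h2 h3 w
  have h1 := (hφ1.hasFDerivAt.comp y hP1.hasFDerivAt).exp
  have h2 := (hφ2.hasFDerivAt.comp y hP1.hasFDerivAt).clm_apply hPw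
  have h3 := ((h1.mul h2).prodMk hPw).congr_of_eventuallyEq e2
  rw [e1, h3.fderiv]
  simp
  ring

/-- The first and second fundamental forms of a radial graph with normal `N`. -/
theorem secondForm_graph [FiniteDimensional ℝ 𝔼] {S : 𝔼 → 𝔼 →L[ℝ] 𝔼 →L[ℝ] ℝ} {F : 𝔼 → ℝ × 𝔼}
    {P : 𝔼 → 𝔼} {φ : 𝔼 → ℝ}
    {y β : 𝔼} {N : ℝ × 𝔼}
    (hS : DifferentiableAt ℝ S (P y))
    (hSpos : ∀ v, v ≠ 0 → 0 < S (P y) v v)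
    (hP : ContDiffAt ℝ 2 P y) (hφ : ContDiffAt ℝ 2 φ (P y))
    (hF : F =ᶠ[𝓝 y] fun y => (Real.exp (φ (P y)), P y))
    (hβ : ∀ v, S (P y) v β = fderiv ℝ φ (P y) v)
    (hN : N.2 = -(N.1 / (F y).1) • β) (v w : 𝔼) :
    -(coneMetric S (F y) (fderiv ℝ (fderiv ℝ F) y v w +
        christoffel (coneMetric S) (F y) (fderiv ℝ F y v) (fderiv ℝ F y w)) N) =
      (N.1 * (F y).1) * (S (P y) (fderiv ℝ P y v) (fderiv ℝ P y w) +
        fderiv ℝ φ (P y) (fderiv ℝ P y v) * fderiv ℝ φ (P y) (fderiv ℝ P y w) -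
        (fderiv ℝ (fderiv ℝ φ) (P y) (fderiv ℝ P y v) (fderiv ℝ P y w) -
          christoffelFirst S (P y) (fderiv ℝ P y v) (fderiv ℝ P y w) β)) := by
  have hFy : F y = (Real.exp (φ (P y)), P y) := hF.eq_of_nhds
  have hρ : (0 : ℝ) < Real.exp (φ (P y)) := Real.exp_pos _
  have hinv : (coneMetric S (F y)).IsInvertible := by
    refine isInvertible_of_apply_self_ne_zero fun a ha => ne_of_gt ?_
    rw [coneMetric_apply, hFy]
    by_cases h : a.2 = 0
    · have : a.1 ≠ 0 := fun h1 => ha (Prod.ext h1 h)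
      simp only [h, map_zero, mul_zero, add_zero]
      exact mul_self_pos.mpr this
    · exact add_pos_of_nonneg_of_pos (mul_self_nonneg _) (mul_pos (pow_pos hρ 2) (hSpos _ h))
  rw [map_add, add_apply, apply_christoffel _ hinv]
  rw [hFy] at hN ⊢
  rw [fderiv_coneMetric hS, fderiv_coneMetric hS, fderiv_coneMetric hS, coneMetric_apply,
    fderiv_fderiv_graph hP hφ hF, fderiv_graph (hP.differentiableAt two_ne_zero)
      (hφ.differentiableAt two_ne_zero) hF, fderiv_graph (hP.differentiableAt two_ne_zero)
      (hφ.differentiableAt two_ne_zero) hF, hN]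
  simp only [map_smul, hβ, smul_eq_mul, smul_apply, christoffelFirst]
  field_simp
  ring

/-- The normal `N` of a flow of radial graphs with velocity `f • N` is determined by the gradient
`β` of the logarithmic radius `Φ`, and `Φ` has the speed `f / (r * N.1)`. -/
theorem graph_normal [FiniteDimensional ℝ 𝔼] {S : 𝔼 → 𝔼 →L[ℝ] 𝔼 →L[ℝ] ℝ} {X : ℝ × 𝔼 → ℝ × 𝔼}
    {Φ : ℝ × 𝔼 → ℝ} {t f : ℝ} {y z : 𝔼} {N : ℝ × 𝔼} (hz : (X (t, y)).2 = z)
    (hX : DifferentiableAt ℝ X (t, y)) (hΦ : DifferentiableAt ℝ Φ (t, z))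
    (hgraph : X =ᶠ[𝓝 (t, y)] fun a => (Real.exp (Φ (a.1, (X a).2)), (X a).2))
    (hunit : coneMetric S (X (t, y)) N N = 1) (hNpos : 0 < N.1)
    (horth : ∀ v, coneMetric S (X (t, y)) (fderiv ℝ (fun y => X (t, y)) y v) N = 0)
    (himm : Function.Injective (fderiv ℝ (fun y => X (t, y)) y))
    (hflow : HasDerivAt (fun s => X (s, y)) (f • N) t) :
    ∃ β, (∀ v, S z v β = fderiv ℝ (fun y => Φ (t, y)) z v) ∧
      N.2 = -(N.1 / (X (t, y)).1) • β ∧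
      N.1 ^ 2 * (1 + fderiv ℝ (fun y => Φ (t, y)) z β) = 1 ∧
      deriv (fun s => Φ (s, z)) t * ((X (t, y)).1 * N.1) = f ∧
      Function.Bijective (fderiv ℝ (fun y => (X (t, y)).2) y) := by
  subst hz
  set φ : 𝔼 → ℝ := fun y => Φ (t, y) with hφdef
  set F : 𝔼 → ℝ × 𝔼 := fun y => X (t, y) with hFdef
  set P : 𝔼 → 𝔼 := fun y => (X (t, y)).2 with hPdef
  have hcurve : DifferentiableAt ℝ (fun y : 𝔼 => (t, y)) y := by fun_prop
  have hP : DifferentiableAt ℝ P y := (DifferentiableAt.comp (g := X) y hX hcurve).snd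
  have hφ : DifferentiableAt ℝ φ (P y) :=
    DifferentiableAt.comp (g := Φ) (P y) hΦ
      (by fun_prop : DifferentiableAt ℝ (fun y : 𝔼 => (t, y)) (P y))
  have hF : F =ᶠ[𝓝 y] fun y => (Real.exp (φ (P y)), P y) :=
    hcurve.continuousAt.eventually hgraph
  have hFy : F y = (Real.exp (φ (P y)), P y) := hF.eq_of_nhds
  have hXy : X (t, y) = (Real.exp (φ (P y)), P y) := hFy
  have hρ : (0 : ℝ) < Real.exp (φ (P y)) := Real.exp_pos _
  have hdF : ∀ w, fderiv ℝ F y w =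
      (Real.exp (φ (P y)) * fderiv ℝ φ (P y) (fderiv ℝ P y w), fderiv ℝ P y w) :=
    fderiv_graph hP hφ hF
  generalize Real.exp (φ (P y)) = ρ at hFy hXy hρ hdF
  have hinj : Function.Injective (fderiv ℝ P y) := by
    intro v w h
    apply himm
    rw [hdF, hdF, h]
  have hsurj : Function.Surjective (fderiv ℝ P y) :=
    LinearMap.injective_iff_surjective (f := (fderiv ℝ P y : 𝔼 →ₗ[ℝ] 𝔼)).mp hinj
  set β : 𝔼 := -(ρ / N.1) • N.2 with hβdef
  have hNβ : N.2 = -(N.1 / ρ) • β := by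
    rw [hβdef, smul_smul]
    have : -(N.1 / ρ) * -(ρ / N.1) = 1 := by field_simp
    rw [this, one_smul]
  have hβ : ∀ v, S (P y) v β = fderiv ℝ φ (P y) v := by
    intro v
    obtain ⟨w, rfl⟩ := hsurj v
    have := horth w
    rw [hdF, hXy, coneMetric_apply] at this
    rw [hβdef, map_smul, smul_eq_mul]
    simp only at this
    have h2 : ρ * S (P y) (fderiv ℝ P y w) N.2 = -(fderiv ℝ φ (P y) (fderiv ℝ P y w) * N.1) := by
      have : ρ * (ρ * S (P y) (fderiv ℝ P y w) N.2 + fderiv ℝ φ (P y) (fderiv ℝ P y w) * N.1) = 0 :=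
        by
        linarith
      rcases mul_eq_zero.mp this with h | h <;> linarith
    field_simp
    linarith
  set α := fderiv ℝ φ (P y) with hα
  have hunit' : N.1 ^ 2 * (1 + α β) = 1 := by
    rw [hXy, coneMetric_apply, hNβ] at hunit
    simp only [map_smul, smul_apply, smul_eq_mul, hβ] at hunit
    field_simp at hunit
    linarith
  have hΦt : deriv (fun s => Φ (s, P y)) t * (ρ * N.1) = f := by
    have h1 : HasDerivAt (fun s => (X (s, y)).2) (f • N.2) t :=
      HasFDerivAt.comp_hasDerivAt (l := Prod.snd) t
        (ContinuousLinearMap.snd ℝ ℝ 𝔼).hasFDerivAt hflow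
    have h2 : HasDerivAt (fun s => (X (s, y)).1) (f * N.1) t :=
      HasFDerivAt.comp_hasDerivAt (l := Prod.fst) t
        (ContinuousLinearMap.fst ℝ ℝ 𝔼).hasFDerivAt hflow
    have h3 : HasDerivAt (fun s => Real.exp (Φ (s, (X (s, y)).2)))
        (ρ * fderiv ℝ Φ (t, P y) (1, f • N.2)) t := by
      have := (HasFDerivAt.comp_hasDerivAt (l := Φ) t hΦ.hasFDerivAt
        ((hasDerivAt_id t).prodMk h1)).exp
      have e : Real.exp (Φ (t, (X (t, y)).2)) = ρ := congrArg Prod.fst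
        (hF.eq_of_nhds.symm.trans hFy)
      simp only [Function.comp_apply, id_eq] at this
      rwa [e] at this
    have h4 : (fun s => (X (s, y)).1) =ᶠ[𝓝 t] fun s => Real.exp (Φ (s, (X (s, y)).2)) := by
      have hc : ContinuousAt (fun s : ℝ => (s, y)) t := by fun_prop
      filter_upwards [hc.eventually hgraph] with s hs
      exact congrArg Prod.fst hs
    have h5 := h2.unique (h3.congr_of_eventuallyEq h4)
    have h6 : deriv (fun s => Φ (s, P y)) t = fderiv ℝ Φ (t, P y) (1, 0) :=
      (HasFDerivAt.comp_hasDerivAt (l := Φ) t hΦ.hasFDerivAt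
        ((hasDerivAt_id t).prodMk (hasDerivAt_const t (P y)))).deriv
    have h7 : α β = fderiv ℝ Φ (t, P y) (0, β) := by
      have : HasFDerivAt φ ((fderiv ℝ Φ (t, P y)).comp (.inr ℝ ℝ 𝔼)) (P y) :=
        HasFDerivAt.comp (g := Φ) (P y) hΦ.hasFDerivAt (hasFDerivAt_prodMk_right t (P y))
      rw [hα, this.fderiv]
      simp
    have h8 : fderiv ℝ Φ (t, P y) (1, f • N.2) =
        fderiv ℝ Φ (t, P y) (1, 0) - f * (N.1 / ρ) * fderiv ℝ Φ (t, P y) (0, β) := by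
      have : ((1 : ℝ), f • N.2) = (1, 0) - (f * (N.1 / ρ)) • ((0 : ℝ), β) := by
        rw [hNβ]
        ext <;> simp [mul_smul]
      rw [this, map_sub, map_smul, smul_eq_mul]
    rw [h8, ← h7, ← h6] at h5
    field_simp at h5
    linear_combination (-N.1) * h5 + f * hunit'
  refine ⟨β, hβ, ?_, hunit', ?_, hinj, hsurj⟩
  · rw [hXy]; exact hNβ
  · rw [hXy]; exact hΦt

end Cone

section GraphTrace

variable {n : ℕ}

local notation "𝔼" => EuclideanSpace ℝ (Fin n)

/-- For a radial graph with logarithmic radius `φ`, the trace of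
`S + dφ ⊗ dφ - ∇²φ` with respect to `S + dφ ⊗ dφ`. Here `∇²φ = φ'' - Γ(dφ^♯)` is the Hessian of `φ`
with respect to the coordinate metric `S`, and `β` stands for the gradient `dφ^♯`. -/
def graphTrace (S : 𝔼 → 𝔼 →L[ℝ] 𝔼 →L[ℝ] ℝ) (φ : 𝔼 → ℝ) (z β : 𝔼) : ℝ :=
  formTrace (fun v w => S z v w + fderiv ℝ φ z v * fderiv ℝ φ z w)
    (fun v w => S z v w + fderiv ℝ φ z v * fderiv ℝ φ z w -
      (fderiv ℝ (fderiv ℝ φ) z v w - christoffelFirst S z v w β))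

/-- The mean curvature of a radial graph in a cone. The left-hand side is the trace of the second
fundamental form of `F` with respect to `N`. The factor `(F y).1 ^ 2` of the first fundamental form
and the factor `N.1 * (F y).1` of the second come out, and the parametrization `P` cancels. -/
theorem formTrace_graph {S : 𝔼 → 𝔼 →L[ℝ] 𝔼 →L[ℝ] ℝ} {F : 𝔼 → ℝ × 𝔼} {P : 𝔼 → 𝔼} {φ : 𝔼 → ℝ}
    {y β : 𝔼} {N : ℝ × 𝔼}
    (hS : DifferentiableAt ℝ S (P y)) (hSpos : ∀ v, v ≠ 0 → 0 < S (P y) v v)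
    (hP : ContDiffAt ℝ 2 P y) (hφ : ContDiffAt ℝ 2 φ (P y))
    (hF : F =ᶠ[𝓝 y] fun y => (Real.exp (φ (P y)), P y))
    (hβ : ∀ v, S (P y) v β = fderiv ℝ φ (P y) v)
    (hN : N.2 = -(N.1 / (F y).1) • β) (hB : Function.Bijective (fderiv ℝ P y)) :
    formTrace (fun v w => coneMetric S (F y) (fderiv ℝ F y v) (fderiv ℝ F y w))
      (fun v w => -(coneMetric S (F y) (fderiv ℝ (fderiv ℝ F) y v w +
        christoffel (coneMetric S) (F y) (fderiv ℝ F y v) (fderiv ℝ F y w)) N)) =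
      N.1 / (F y).1 * graphTrace S φ (P y) β := by
  have hFy : F y = (Real.exp (φ (P y)), P y) := hF.eq_of_nhds
  have hρ : (0 : ℝ) < Real.exp (φ (P y)) := Real.exp_pos _
  simp_rw [secondForm_graph hS hSpos hP hφ hF hβ hN, coneMetric_apply,
    fderiv_graph (hP.differentiableAt two_ne_zero) (hφ.differentiableAt two_ne_zero) hF]
  rw [hFy]
  generalize Real.exp (φ (P y)) = ρ at hρ
  set B : 𝔼 ≃ₗ[ℝ] 𝔼 := LinearEquiv.ofBijective (fderiv ℝ P y : 𝔼 →ₗ[ℝ] 𝔼) hB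
  let g : 𝔼 →ₗ[ℝ] 𝔼 →ₗ[ℝ] ℝ := LinearMap.mk₂ ℝ
    (fun v w => S (P y) v w + fderiv ℝ φ (P y) v * fderiv ℝ φ (P y) w)
    (by intros; simp; ring) (by intros; simp; ring) (by intros; simp; ring) (by intros; simp; ring)
  let h : 𝔼 →ₗ[ℝ] 𝔼 →ₗ[ℝ] ℝ := LinearMap.mk₂ ℝ
    (fun v w => S (P y) v w + fderiv ℝ φ (P y) v * fderiv ℝ φ (P y) w -
      (fderiv ℝ (fderiv ℝ φ) (P y) v w - christoffelFirst S (P y) v w β))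
    (by intros; simp [christoffelFirst]; ring) (by intros; simp [christoffelFirst]; ring)
    (by intros; simp [christoffelFirst]; ring) (by intros; simp [christoffelFirst]; ring)
  have e1 : (fun v w => ρ * fderiv ℝ φ (P y) (fderiv ℝ P y v) *
      (ρ * fderiv ℝ φ (P y) (fderiv ℝ P y w)) +
      ρ ^ 2 * S (P y) (fderiv ℝ P y v) (fderiv ℝ P y w)) =
      fun v w => ρ ^ 2 * g (B v) (B w) := by
    ext v w
    change _ = ρ ^ 2 * (S (P y) (fderiv ℝ P y v) (fderiv ℝ P y w) +
      fderiv ℝ φ (P y) (fderiv ℝ P y v) * fderiv ℝ φ (P y) (fderiv ℝ P y w))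
    ring
  rw [e1]
  change formTrace (fun v w => ρ ^ 2 * g (B v) (B w)) (fun v w => (N.1 * ρ) * h (B v) (B w)) = _
  rw [formTrace_smul (fun v w => g (B v) (B w)) (fun v w => h (B v) (B w)) _ _ (by positivity),
    formTrace_comp g h B]
  change _ * graphTrace S φ (P y) β = _
  field_simp

/-- The speed of the logarithmic radius `Φ` of a flow of radial graphs with velocity `N / H`.
The mean curvature is `N.1 / r` times the trace `graphTrace`, and the speed is the inverse of
`r * N.1 * H`, so that the product of the speed and `graphTrace` depends on the gradient only. -/
theorem graph_speed {S : 𝔼 → 𝔼 →L[ℝ] 𝔼 →L[ℝ] ℝ} {X : ℝ × 𝔼 → ℝ × 𝔼} {Φ : ℝ × 𝔼 → ℝ}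
    {t H : ℝ} {y z : 𝔼} {N : ℝ × 𝔼} (hz : (X (t, y)).2 = z)
    (hS : DifferentiableAt ℝ S z) (hSpos : ∀ v, v ≠ 0 → 0 < S z v v)
    (hX : ContDiffAt ℝ 2 X (t, y)) (hΦ : ContDiffAt ℝ 2 Φ (t, z))
    (hgraph : X =ᶠ[𝓝 (t, y)] fun a => (Real.exp (Φ (a.1, (X a).2)), (X a).2))
    (hunit : coneMetric S (X (t, y)) N N = 1) (hNpos : 0 < N.1)
    (horth : ∀ v, coneMetric S (X (t, y)) (fderiv ℝ (fun y => X (t, y)) y v) N = 0)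
    (himm : Function.Injective (fderiv ℝ (fun y => X (t, y)) y))
    (hH : H = formTrace
      (fun v w => coneMetric S (X (t, y)) (fderiv ℝ (fun y => X (t, y)) y v)
        (fderiv ℝ (fun y => X (t, y)) y w))
      (fun v w => -(coneMetric S (X (t, y)) (fderiv ℝ (fderiv ℝ (fun y => X (t, y))) y v w +
        christoffel (coneMetric S) (X (t, y)) (fderiv ℝ (fun y => X (t, y)) y v)
          (fderiv ℝ (fun y => X (t, y)) y w)) N)))
    (hH0 : H ≠ 0) (hflow : HasDerivAt (fun s => X (s, y)) (H⁻¹ • N) t) :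
    ∃ β, (∀ v, S z v β = fderiv ℝ (fun y => Φ (t, y)) z v) ∧
      deriv (fun s => Φ (s, z)) t * graphTrace S (fun y => Φ (t, y)) z β =
        1 + fderiv ℝ (fun y => Φ (t, y)) z β ∧
      deriv (fun s => Φ (s, z)) t * ((X (t, y)).1 * N.1) = H⁻¹ := by
  obtain ⟨β, hβ, hN, hunit', hspeed, hbij⟩ := graph_normal hz (hX.differentiableAt two_ne_zero)
    (hΦ.differentiableAt two_ne_zero) hgraph hunit hNpos horth himm hflow
  refine ⟨β, hβ, ?_, hspeed⟩
  subst hz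
  have hcurve : ContDiffAt ℝ 2 (fun y : 𝔼 => (t, y)) y := contDiffAt_const.prodMk contDiffAt_id
  have hXc : ContDiffAt ℝ 2 (fun y => X (t, y)) y := ContDiffAt.comp (g := X) y hX hcurve
  have hφ : ContDiffAt ℝ 2 (fun y => Φ (t, y)) (X (t, y)).2 :=
    ContDiffAt.comp (g := Φ) _ hΦ (contDiffAt_const.prodMk contDiffAt_id)
  have hF : (fun y => X (t, y)) =ᶠ[𝓝 y] fun y => (Real.exp (Φ (t, (X (t, y)).2)), (X (t, y)).2) :=
    hcurve.continuousAt.eventually hgraph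
  rw [formTrace_graph (P := fun y => (X (t, y)).2) (φ := fun y => Φ (t, y)) hS hSpos hXc.snd hφ hF
    hβ hN hbij] at hH
  have hρ : 0 < (X (t, y)).1 := by
    rw [hgraph.eq_of_nhds]; exact Real.exp_pos _
  have h1 : N.1 ^ 2 * (deriv (fun s => Φ (s, (X (t, y)).2)) t *
      graphTrace S (fun y => Φ (t, y)) (X (t, y)).2 β) = 1 := by
    have h2 : deriv (fun s => Φ (s, (X (t, y)).2)) t * ((X (t, y)).1 * N.1) * H = 1 := by
      rw [hspeed, inv_mul_cancel₀ hH0]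
    rw [← h2]
    generalize deriv (fun s => Φ (s, (X (t, y)).2)) t = a
    generalize (X (t, y)).1 = r at hH hρ
    rw [hH]
    field_simp
  have h3 : N.1 ^ 2 ≠ 0 := by positivity
  apply mul_left_cancel₀ h3
  rw [h1, hunit']

end GraphTrace

/-! ### The metric and the mean curvature in charts -/

section Charts

variable {n : ℕ} {M : Type*} [TopologicalSpace M] [ChartedSpace (EuclideanSpace ℝ (Fin n)) M]

local notation "𝔼" => EuclideanSpace ℝ (Fin n)

theorem mfderiv_extChartAt_symm_self [IsManifold (𝓡 n) ∞ M] (q : M) :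
    (mfderiv 𝓘(ℝ, 𝔼) (𝓡 n) (extChartAt (𝓡 n) q).symm (extChartAt (𝓡 n) q q) : 𝔼 →L[ℝ] 𝔼) =
      ContinuousLinearMap.id ℝ 𝔼 := by
  have : IsManifold (𝓡 n) 1 M := .of_le (n := ∞) (by simp)
  have h := mfderivWithin_range_extChartAt_symm (I := 𝓡 n) (x := q)
  rw [ModelWithCorners.range_eq_univ, mfderivWithin_univ] at h
  exact h

theorem chartMetric_self [IsManifold (𝓡 n) ∞ M]
    (g : ∀ q : M, TangentSpace (𝓡 n) q →L[ℝ] TangentSpace (𝓡 n) q →L[ℝ] ℝ) (q : M) (v w : 𝔼) :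
    chartMetric (𝓡 n) g q (extChartAt (𝓡 n) q q) v w = g q v w := by
  unfold chartMetric
  simp only
  rw [mfderiv_extChartAt_symm_self, extChartAt_to_inv]
  rfl

theorem extChartAt_coneModel (a : ℝ × M) :
    extChartAt (coneModel n) a = (PartialEquiv.refl ℝ).prod (extChartAt (𝓡 n) a.2) := by
  rw [extChartAt_prod, extChartAt_model_space_eq_id]

theorem chartMetric_warpedMetric [IsManifold (𝓡 n) ∞ M]
    (g : ∀ q : M, TangentSpace (𝓡 n) q →L[ℝ] TangentSpace (𝓡 n) q →L[ℝ] ℝ) (a : ℝ × M) {z : ℝ × 𝔼}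
    (hz : z.2 ∈ (extChartAt (𝓡 n) a.2).target) :
    chartMetric (coneModel n) (warpedMetric g) a z = coneMetric (chartMetric (𝓡 n) g a.2) z := by
  have : IsManifold (𝓡 n) 1 M := .of_le (n := ∞) (by simp)
  have h1 : ((extChartAt (coneModel n) a).symm : ℝ × 𝔼 → ℝ × M) = Prod.map id
    (extChartAt (𝓡 n) a.2).symm := by
    rw [extChartAt_coneModel]; rfl
  have h2 : MDifferentiableAt 𝓘(ℝ, 𝔼) (𝓡 n) (extChartAt (𝓡 n) a.2).symm z.2 := by
    have := mdifferentiableWithinAt_extChartAt_symm (I := 𝓡 n) hz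
    rwa [ModelWithCorners.range_eq_univ, mdifferentiableWithinAt_univ] at this
  have h3 : (mfderiv 𝓘(ℝ, ℝ × 𝔼) (coneModel n) (extChartAt (coneModel n) a).symm z :
      ℝ × 𝔼 →L[ℝ] ℝ × 𝔼) = (ContinuousLinearMap.id ℝ ℝ).prodMap
        (mfderiv 𝓘(ℝ, 𝔼) (𝓡 n) (extChartAt (𝓡 n) a.2).symm z.2 : 𝔼 →L[ℝ] 𝔼) := by
    rw [h1]
    have := mfderiv_prodMap (I := 𝓘(ℝ, ℝ)) (J := 𝓘(ℝ, ℝ)) (I' := 𝓘(ℝ, 𝔼)) (J' := 𝓡 n) (f := id)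
      (p := z)
      mdifferentiableAt_id h2
    rw [mfderiv_id] at this
    rw [modelWithCornersSelf_prod, ← chartedSpaceSelf_prod]
    exact this
  refine ContinuousLinearMap.ext fun v => ContinuousLinearMap.ext fun w => ?_
  rw [coneMetric_apply]
  unfold chartMetric
  simp only
  rw [h3, h1]
  change v.1 * w.1 + z.1 ^ 2 * _ = _
  rfl

theorem trivializationAt_symm_apply [IsManifold (𝓡 n) ∞ M] {q : M} {z : 𝔼}
    (hz : z ∈ (extChartAt (𝓡 n) q).target) (v : 𝔼) :
    (trivializationAt 𝔼 (TangentSpace (𝓡 n)) q).symm ((extChartAt (𝓡 n) q).symm z) v =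
      mfderiv 𝓘(ℝ, 𝔼) (𝓡 n) (extChartAt (𝓡 n) q).symm z v := by
  have : IsManifold (𝓡 n) 1 M := .of_le (n := ∞) (by simp)
  have hb : (extChartAt (𝓡 n) q).symm z ∈ (chartAt 𝔼 q).source := by
    rw [← extChartAt_source (I := 𝓡 n)]
    exact (extChartAt (𝓡 n) q).map_target hz
  have h4 := TangentBundle.symmL_trivializationAt (I := 𝓡 n) hb
  rw [ModelWithCorners.range_eq_univ, mfderivWithin_univ, (extChartAt (𝓡 n) q).right_inv hz] at h4
  rw [← Bundle.Trivialization.symmL_apply (R := ℝ) _ (by simpa using hb), h4]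
  rfl

theorem differentiableAt_chartMetric [IsManifold (𝓡 n) ∞ M]
    (σ : Bundle.ContMDiffRiemannianMetric (𝓡 n) ∞ 𝔼 (fun p : M => TangentSpace (𝓡 n) p)) (q : M) :
    DifferentiableAt ℝ (chartMetric (𝓡 n) σ.inner q) (extChartAt (𝓡 n) q q) := by
  have : IsManifold (𝓡 n) 1 M := .of_le (n := ∞) (by simp)
  have h := (contMDiffAt_hom_bundle _).mp (σ.contMDiff q)
  have h2 := h.2
  simp only at h2
  have hs : ContMDiffAt 𝓘(ℝ, 𝔼) (𝓡 n) ∞ (extChartAt (𝓡 n) q).symm (extChartAt (𝓡 n) q q) :=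
    (contMDiffOn_extChartAt_symm q).contMDiffAt (extChartAt_target_mem_nhds q)
  have hq : (extChartAt (𝓡 n) q).symm (extChartAt (𝓡 n) q q) = q := extChartAt_to_inv q
  have h3 := (ContMDiffAt.comp_of_eq h2 hs hq).contDiffAt
  refine (h3.differentiableAt (by simp)).congr_of_eventuallyEq ?_
  filter_upwards [extChartAt_target_mem_nhds (I := 𝓡 n) q] with z hz
  have hb : (extChartAt (𝓡 n) q).symm z ∈ (chartAt 𝔼 q).source := by
    rw [← extChartAt_source (I := 𝓡 n)]
    exact (extChartAt (𝓡 n) q).map_target hz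
  ext v w
  simp only [Function.comp_apply]
  rw [inCoordinates_apply_eq₂ (by simpa using hb) (by simpa using hb) (by simp)]
  rw [trivializationAt_symm_apply hz, trivializationAt_symm_apply hz]
  simp
  rfl

end Charts

/-! ### The flow in charts -/

section FlowCharts

variable {n : ℕ} {M : Type*} [TopologicalSpace M] [ChartedSpace (EuclideanSpace ℝ (Fin n)) M]

local notation "𝔼" => EuclideanSpace ℝ (Fin n)

/-- The components of a tangent vector of `ℝ × M` in the preferred chart at its base point. -/
def tangentCoord {a : ℝ × M} (v : TangentSpace (coneModel n) a) : ℝ × 𝔼 := v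

theorem warpedMetric_apply
    (g : ∀ q : M, TangentSpace (𝓡 n) q →L[ℝ] TangentSpace (𝓡 n) q →L[ℝ] ℝ) (a : ℝ × M)
    (v w : TangentSpace (coneModel n) a) :
    warpedMetric g a v w = (tangentCoord v).1 * (tangentCoord w).1 +
      a.1 ^ 2 * g a.2 (tangentCoord v).2 (tangentCoord w).2 := rfl

/-- The mean curvature in the preferred charts, where the metric is a cone metric. -/
theorem meanCurvature_warpedMetric [IsManifold (𝓡 n) ∞ M]
    (g : ∀ q : M, TangentSpace (𝓡 n) q →L[ℝ] TangentSpace (𝓡 n) q →L[ℝ] ℝ) (f : M → ℝ × M)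
    (ν : ∀ p : M, TangentSpace (coneModel n) (f p)) (p : M) {F : 𝔼 → ℝ × 𝔼}
    (hF : F = writtenInExtChartAt (𝓡 n) (coneModel n) p f) {y : 𝔼} (hy : y = extChartAt (𝓡 n) p p)
    {N : ℝ × 𝔼} (hN : N = tangentCoord (ν p)) {S : 𝔼 → 𝔼 →L[ℝ] 𝔼 →L[ℝ] ℝ}
      (hS : S = chartMetric (𝓡 n) g (f p).2) :
    meanCurvature (n := n) (coneModel n) (warpedMetric g) f ν p =
      formTrace
        (fun v w => coneMetric S (F y) (fderiv ℝ F y v) (fderiv ℝ F y w))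
        (fun v w => -(coneMetric S (F y) (fderiv ℝ (fderiv ℝ F) y v w +
          christoffel (coneMetric S) (F y) (fderiv ℝ F y v) (fderiv ℝ F y w)) N)) := by
  have : IsManifold (𝓡 n) 1 M := .of_le (n := ∞) (by simp)
  have hFy : F y = extChartAt (coneModel n) (f p) (f p) := by
    rw [hF, hy, writtenInExtChartAt]
    simp only [Function.comp_apply, extChartAt_to_inv]
  have hFy2 : (F y).2 = extChartAt (𝓡 n) (f p).2 (f p).2 := by
    rw [hFy, extChartAt_coneModel]; rfl
  have hG : chartMetric (coneModel n) (warpedMetric g) (f p) =ᶠ[𝓝 (F y)] coneMetric S := by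
    have h1 : ∀ᶠ z : ℝ × 𝔼 in 𝓝 (F y), z.2 ∈ (extChartAt (𝓡 n) (f p).2).target := by
      apply continuous_snd.continuousAt.eventually
      rw [hFy2]
      exact extChartAt_target_mem_nhds _
    filter_upwards [h1] with z hz
    rw [hS]
    exact chartMetric_warpedMetric g (f p) hz
  have hGamma : ∀ a b, christoffel (chartMetric (coneModel n) (warpedMetric g) (f p)) (F y) a b =
      christoffel (coneMetric S) (F y) a b := by
    intro a b
    unfold christoffel
    rw [hG.fderiv_eq, hG.eq_of_nhds]
  have hν : (mfderiv (coneModel n) 𝓘(ℝ, ℝ × 𝔼) (extChartAt (coneModel n) (f p)) (f p) (ν p) : ℝ × 𝔼)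
    =
      N := by
    rw [mfderiv_extChartAt_self, hN]
    rfl
  unfold meanCurvature formTrace formMatrix inducedMetric secondFundamentalForm
  simp only
  rw [← hF, ← hy, hν]
  simp_rw [hGamma]
  rw [hG.eq_of_nhds]

variable {T : EReal} {u₀ : M → ℝ} {x : ℝ → M → ℝ × M}

theorem timeInterval_mem_nhds {t : ℝ} (ht : t ∈ timeInterval T) (ht0 : 0 < t) :
    timeInterval T ∈ 𝓝 t := by
  have h1 : ∀ᶠ s : ℝ in 𝓝 t, (s : EReal) < T :=
    continuous_coe_real_ereal.continuousAt.eventually (gt_mem_nhds ht.2)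
  filter_upwards [h1, lt_mem_nhds ht0] with s hs hs0 using ⟨hs0.le, hs⟩

/-- The flow `x` in the preferred charts at `p` and at `x t p`, as a map on space-time. -/
def flowChart (x : ℝ → M → ℝ × M) (t : ℝ) (p : M) (a : ℝ × 𝔼) : ℝ × 𝔼 :=
  ((x a.1 ((extChartAt (𝓡 n) p).symm a.2)).1,
    extChartAt (𝓡 n) (x t p).2 (x a.1 ((extChartAt (𝓡 n) p).symm a.2)).2)

theorem flowChart_eq (x : ℝ → M → ℝ × M) (t : ℝ) (p : M) (a : ℝ × 𝔼) :
    flowChart x t p a =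
      extChartAt (coneModel n) (x t p) (x a.1 ((extChartAt (𝓡 n) p).symm a.2)) := by
  rw [extChartAt_coneModel]; rfl

theorem flowChart_slice (x : ℝ → M → ℝ × M) (t : ℝ) (p : M) :
    (fun y => flowChart x t p (t, y)) = writtenInExtChartAt (𝓡 n) (coneModel n) p (x t) := by
  funext y
  rw [flowChart_eq]
  rfl

theorem flowChart_self (x : ℝ → M → ℝ × M) (t : ℝ) (p : M) :
    flowChart x t p (t, extChartAt (𝓡 n) p p) = ((x t p).1, extChartAt (𝓡 n) (x t p).2 (x t p).2) :=
      by
  simp [flowChart]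

theorem fderiv_flowChart {t : ℝ} {p : M}
    (h : MDifferentiableAt (𝓡 n) (coneModel n) (x t) p) (v : 𝔼) :
    fderiv ℝ (fun y => flowChart x t p (t, y)) (extChartAt (𝓡 n) p p) v =
      tangentCoord (mfderiv (𝓡 n) (coneModel n) (x t) p v) := by
  rw [flowChart_slice, ← fderivWithin_univ, ← ModelWithCorners.range_eq_univ (𝓡 n)]
  unfold tangentCoord mfderiv
  simp only [h]
  rfl

variable [IsManifold (𝓡 n) ∞ M]
  {σ : ∀ q : M, TangentSpace (𝓡 n) q →L[ℝ] TangentSpace (𝓡 n) q →L[ℝ] ℝ}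
  {ν : ∀ (t : ℝ) (p : M), TangentSpace (coneModel n) (x t p)}

theorem IsSolution.contMDiffAt (hx : IsSolution σ T u₀ x ν) {t : ℝ} (ht : t ∈ timeInterval T)
    (ht0 : 0 < t) (p : M) :
    ContMDiffAt (𝓘(ℝ, ℝ).prod (𝓡 n)) (coneModel n) ∞ (fun z : ℝ × M => x z.1 z.2) (t, p) := by
  refine hx.smooth.contMDiffAt ?_
  have h1 : {s | s ∈ timeInterval T ∧ 0 < s} ∈ 𝓝 t :=
    Filter.inter_mem (timeInterval_mem_nhds ht ht0) (lt_mem_nhds ht0)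
  exact (continuous_fst.continuousAt (x := (t, p))).preimage_mem_nhds h1

theorem IsSolution.contDiffAt_flowChart (hx : IsSolution σ T u₀ x ν) {t : ℝ}
    (ht : t ∈ timeInterval T) (ht0 : 0 < t) (p : M) :
    ContDiffAt ℝ ∞ (flowChart x t p) (t, extChartAt (𝓡 n) p p) := by
  have h := (contMDiffAt_iff.mp (hx.contMDiffAt ht ht0 p)).2
  rw [ModelWithCorners.range_eq_univ, contDiffWithinAt_univ, extChartAt_coneModel] at h
  have e : flowChart x t p = (extChartAt (coneModel n) (x (t, p).1 (t, p).2)) ∘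
      (fun z : ℝ × M => x z.1 z.2) ∘ ((PartialEquiv.refl ℝ).prod (extChartAt (𝓡 n) (t, p).2)).symm
        := by
    funext a
    rw [flowChart_eq]
    rfl
  rw [e]
  exact h

theorem IsSolution.mdifferentiableAt (hx : IsSolution σ T u₀ x ν) {t : ℝ} (ht : t ∈ timeInterval T)
    (ht0 : 0 < t) (p : M) : MDifferentiableAt (𝓡 n) (coneModel n) (x t) p := by
  have h := (hx.contMDiffAt ht ht0 p).mdifferentiableAt (by simp)
  exact MDifferentiableAt.comp (I' := 𝓘(ℝ, ℝ).prod (𝓡 n)) (g := fun z : ℝ × M => x z.1 z.2) p h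
    (mdifferentiableAt_const.prodMk mdifferentiableAt_id)

theorem IsSolution.hasDerivWithinAt_flowChart (hx : IsSolution σ T u₀ x ν) {t : ℝ}
    (ht : t ∈ timeInterval T) (p : M) :
    HasDerivWithinAt (fun s => flowChart x t p (s, extChartAt (𝓡 n) p p))
      ((meanCurvature (n := n) (coneModel n) (warpedMetric σ) (x t) (ν t) p)⁻¹ •
        tangentCoord (ν t p)) (timeInterval T) t := by
  have h := (hx.flow t ht p).2
  have e : (fun s => flowChart x t p (s, extChartAt (𝓡 n) p p)) =
      writtenInExtChartAt 𝓘(ℝ, ℝ) (coneModel n) t (fun s => x s p) := by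
    funext s
    rw [flowChart_eq, extChartAt_to_inv]
    rfl
  rw [e, hasDerivWithinAt_iff_hasFDerivWithinAt]
  have h2 : (extChartAt 𝓘(ℝ, ℝ) t).symm ⁻¹' timeInterval T ∩ range 𝓘(ℝ, ℝ) = timeInterval T := by
    rw [extChartAt_model_space_eq_id]
    simp
  rw [h2] at h
  exact h

theorem IsSolution.hasDerivWithinAt_radius (hx : IsSolution σ T u₀ x ν) {t : ℝ}
    (ht : t ∈ timeInterval T) (p : M) :
    HasDerivWithinAt (fun s => (x s p).1)
      ((meanCurvature (n := n) (coneModel n) (warpedMetric σ) (x t) (ν t) p)⁻¹ *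
        (tangentCoord (ν t p)).1) (timeInterval T) t := by
  have h := (ContinuousLinearMap.fst ℝ ℝ 𝔼).hasFDerivAt.comp_hasDerivWithinAt t
    (hx.hasDerivWithinAt_flowChart ht p)
  have h' : HasDerivWithinAt (fun s => (x s p).1)
      ((meanCurvature (n := n) (coneModel n) (warpedMetric σ) (x t) (ν t) p)⁻¹ •
        tangentCoord (ν t p)).1 (timeInterval T) t := by
    have e : (fun s => (x s p).1) = ContinuousLinearMap.fst ℝ ℝ 𝔼 ∘
        fun s => flowChart x t p (s, extChartAt (𝓡 n) p p) := by
      funext s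
      simp [flowChart]
    rw [e]
    exact h
  rwa [Prod.smul_fst, smul_eq_mul] at h'

/-- The evolution of the logarithmic radius `φ` of a solution that consists of radial graphs, in
the preferred chart at a point. -/
theorem IsSolution.graph_speed
    {σ : Bundle.ContMDiffRiemannianMetric (𝓡 n) ∞ 𝔼 (fun p : M => TangentSpace (𝓡 n) p)}
    (hx : IsSolution σ.inner T u₀ x ν) {t : ℝ} (ht : t ∈ timeInterval T) (ht0 : 0 < t) (p : M)
    (hpos : 0 < (tangentCoord (ν t p)).1) {φ : ℝ → M → ℝ} {q : M} (hq : (x t p).2 = q)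
    (hφ : ContDiffAt ℝ 2 (fun a : ℝ × 𝔼 => φ a.1 ((extChartAt (𝓡 n) q).symm a.2))
      (t, extChartAt (𝓡 n) q q))
    (hgraph : ∀ᶠ s in 𝓝 t, ∀ p, (x s p).1 = Real.exp (φ s (x s p).2)) :
    ∃ β, (∀ v, chartMetric (𝓡 n) σ.inner q (extChartAt (𝓡 n) q q) v β =
        fderiv ℝ (fun y => φ t ((extChartAt (𝓡 n) q).symm y)) (extChartAt (𝓡 n) q q) v) ∧
      deriv (fun s => φ s q) t * graphTrace (chartMetric (𝓡 n) σ.inner q)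
        (fun y => φ t ((extChartAt (𝓡 n) q).symm y)) (extChartAt (𝓡 n) q q) β =
        1 + fderiv ℝ (fun y => φ t ((extChartAt (𝓡 n) q).symm y)) (extChartAt (𝓡 n) q q) β ∧
      deriv (fun s => φ s q) t * ((x t p).1 * (tangentCoord (ν t p)).1) =
        (meanCurvature (n := n) (coneModel n) (warpedMetric σ.inner) (x t) (ν t) p)⁻¹ := by
  subst hq
  have hself := flowChart_self (n := n) x t p
  have hX := hx.contDiffAt_flowChart ht ht0 p
  have hmd := hx.mdifferentiableAt ht ht0 p
  have hcone : ∀ v w : TangentSpace (coneModel n) (x t p),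
      coneMetric (chartMetric (𝓡 n) σ.inner (x t p).2)
        (flowChart x t p (t, extChartAt (𝓡 n) p p)) (tangentCoord v) (tangentCoord w) =
        warpedMetric σ.inner (x t p) v w := by
    intro v w
    rw [hself, coneMetric_apply, chartMetric_self, warpedMetric_apply]
  have hcont : ContinuousAt (fun a : ℝ × 𝔼 => (x a.1 ((extChartAt (𝓡 n) p).symm a.2)).2)
      (t, extChartAt (𝓡 n) p p) := by
    have h1 : ContinuousAt (fun z : ℝ × M => x z.1 z.2) (t, p) :=
      (hx.contMDiffAt ht ht0 p).continuousAt
    have h2 : ContinuousAt (fun a : ℝ × 𝔼 => (a.1, (extChartAt (𝓡 n) p).symm a.2))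
        (t, extChartAt (𝓡 n) p p) :=
      continuousAt_fst.prodMk (ContinuousAt.comp_of_eq (continuousAt_extChartAt_symm p)
        continuousAt_snd rfl)
    exact continuous_snd.continuousAt.comp (ContinuousAt.comp_of_eq h1 h2 (by simp))
  have key := IMCF.graph_speed (S := chartMetric (𝓡 n) σ.inner (x t p).2) (X := flowChart x t p)
    (Φ := fun a : ℝ × 𝔼 => φ a.1 ((extChartAt (𝓡 n) (x t p).2).symm a.2)) (t := t)
    (H := meanCurvature (n := n) (coneModel n) (warpedMetric σ.inner) (x t) (ν t) p)
    (y := extChartAt (𝓡 n) p p) (z := extChartAt (𝓡 n) (x t p).2 (x t p).2)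
    (N := tangentCoord (ν t p)) (congrArg Prod.snd hself)
    (differentiableAt_chartMetric σ _)
    (fun v hv => by rw [chartMetric_self]; exact σ.pos _ v hv)
    (hX.of_le (by norm_cast)) hφ ?_ ?_ hpos ?_ ?_ ?_ ?_ ?_
  · simpa only [hself, extChartAt_to_inv] using key
  · have hs : ∀ᶠ a : ℝ × 𝔼 in 𝓝 (t, extChartAt (𝓡 n) p p),
        (x a.1 ((extChartAt (𝓡 n) p).symm a.2)).2 ∈ (extChartAt (𝓡 n) (x t p).2).source := by
      apply hcont.eventually
      simp only [extChartAt_to_inv]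
      exact extChartAt_source_mem_nhds _
    have hg : ∀ᶠ a : ℝ × 𝔼 in 𝓝 (t, extChartAt (𝓡 n) p p),
        ∀ p, (x a.1 p).1 = Real.exp (φ a.1 (x a.1 p).2) :=
      (continuousAt_fst (p := (t, extChartAt (𝓡 n) p p))).eventually hgraph
    filter_upwards [hs, hg] with a h1 h2
    refine Prod.ext ?_ rfl
    simp only [flowChart]
    rw [(extChartAt (𝓡 n) (x t p).2).left_inv h1]
    exact h2 _
  · rw [hcone]
    exact hx.normal_unit t ht p
  · intro v
    rw [fderiv_flowChart hmd, hcone]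
    exact hx.normal_orthogonal t ht p v
  · intro v w h
    rw [fderiv_flowChart hmd, fderiv_flowChart hmd] at h
    exact hx.immersion t ht p h
  · exact meanCurvature_warpedMetric σ.inner (x t) (ν t) p (flowChart_slice x t p) rfl rfl rfl
  · exact hx.meanCurvature_ne_zero t ht p
  · exact (hx.hasDerivWithinAt_flowChart ht p).hasDerivAt (timeInterval_mem_nhds ht ht0)

end FlowCharts

/-! ### Local bijectivity of the radial projection -/

section LocalInverse

/-- A family of maps whose derivatives are jointly continuous at a point, with an invertible
derivative there, is injective on a ball and open at its centre, uniformly in the parameter. -/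
theorem exists_ball_injOn_and_image {E : Type*} [NormedAddCommGroup E] [NormedSpace ℝ E]
    [FiniteDimensional ℝ E] {f : ℝ → E → E} {J : Set ℝ} {t₀ : ℝ} {y₀ : E}
    (hd : ∀ᶠ a in 𝓝[J ×ˢ univ] (t₀, y₀), DifferentiableAt ℝ (f a.1) a.2)
    (hc : ContinuousWithinAt (fun a : ℝ × E => fderiv ℝ (f a.1) a.2) (J ×ˢ univ) (t₀, y₀))
    (hf : ContinuousWithinAt (fun t => f t y₀) J t₀)
    (hA : Function.Bijective (fderiv ℝ (f t₀) y₀)) :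
    ∃ δ > 0, (∀ᶠ t in 𝓝[J] t₀, InjOn (f t) (Metric.ball y₀ δ)) ∧
      ∀ ε > 0, ε < δ → ∃ r > 0, ∀ᶠ t in 𝓝[J] t₀,
        Metric.closedBall (f t₀ y₀) r ⊆ f t '' Metric.closedBall y₀ ε := by
  have : CompleteSpace E := FiniteDimensional.complete ℝ E
  set A : E ≃L[ℝ] E :=
    (LinearEquiv.ofBijective (fderiv ℝ (f t₀) y₀ : E →ₗ[ℝ] E) hA).toContinuousLinearEquiv with hAdef
  have hAcoe : (A : E →L[ℝ] E) = fderiv ℝ (f t₀) y₀ := by ext v; rfl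
  -- increasing the norm of the inverse by `1` keeps `K` positive in dimension zero
  let K : NNReal := ‖(A.symm : E →L[ℝ] E)‖₊ + 1
  have hK : 0 < K := by positivity
  let R : (A : E →L[ℝ] E).NonlinearRightInverse :=
    { toFun := A.symm
      nnnorm := K
      bound' := fun y => by
        refine ((A.symm : E →L[ℝ] E).le_opNorm y).trans ?_
        gcongr
        simp [K]
      right_inv' := fun y => by simp }
  let c : NNReal := K⁻¹ / 2
  have hcpos : 0 < c := by positivity
  have hcK : c < K⁻¹ := NNReal.half_lt_self (by positivity)
  have hnear : ∀ᶠ a in 𝓝[J ×ˢ univ] (t₀, y₀),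
      DifferentiableAt ℝ (f a.1) a.2 ∧ ‖fderiv ℝ (f a.1) a.2 - A‖ ≤ c := by
    refine hd.and ?_
    have h := (hc.sub (continuousWithinAt_const (b := (A : E →L[ℝ] E)))).norm
    have h0 : ‖fderiv ℝ (f t₀) y₀ - (A : E →L[ℝ] E)‖ < c := by
      rw [hAcoe, sub_self, norm_zero]
      exact_mod_cast hcpos
    exact (h.eventually (gt_mem_nhds h0)).mono fun a ha => ha.le
  rw [nhdsWithin_prod_eq, nhdsWithin_univ, Filter.eventually_prod_iff] at hnear
  obtain ⟨pa, hpa, pb, hpb, hab⟩ := hnear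
  obtain ⟨δ, hδ, hball⟩ := Metric.eventually_nhds_iff_ball.mp hpb
  have happ : ∀ t, pa t → ApproximatesLinearOn (f t) (A : E →L[ℝ] E) (Metric.ball y₀ δ) c := by
    intro t ht y hy z hz
    exact (convex_ball y₀ δ).norm_image_sub_le_of_norm_fderiv_le'
      (fun w hw => (hab ht (hball w hw)).1) (fun w hw => (hab ht (hball w hw)).2) hz hy
  refine ⟨δ, hδ, ?_, ?_⟩
  · filter_upwards [hpa] with t ht
    refine (happ t ht).injOn ?_
    rcases subsingleton_or_nontrivial E with h | h
    · exact Or.inl h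
    · refine Or.inr (hcK.trans_le ?_)
      have hN : 0 < ‖(A.symm : E →L[ℝ] E)‖₊ := A.nnnorm_symm_pos
      exact inv_anti₀ hN (by simp [K])
  · intro ε hε hεδ
    have hr : (0 : ℝ) < ((K : ℝ)⁻¹ - c) * ε := by
      refine mul_pos (sub_pos.mpr ?_) hε
      exact_mod_cast hcK
    refine ⟨((K : ℝ)⁻¹ - c) * ε / 2, by linarith, ?_⟩
    have hclose : ∀ᶠ t in 𝓝[J] t₀, dist (f t y₀) (f t₀ y₀) < ((K : ℝ)⁻¹ - c) * ε / 2 :=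
      hf.eventually (Metric.ball_mem_nhds _ (by linarith))
    filter_upwards [hpa, hclose] with t ht htc
    have hsurj := (happ t ht).surjOn_closedBall_of_nonlinearRightInverse R hε.le
      (Metric.closedBall_subset_ball hεδ)
    refine Subset.trans ?_ hsurj
    intro z hz
    rw [Metric.mem_closedBall] at hz ⊢
    have := dist_triangle z (f t₀ y₀) (f t y₀)
    rw [dist_comm (f t₀ y₀)] at this
    change _ ≤ ((K : ℝ)⁻¹ - c) * ε
    linarith

end LocalInverse

section Trivialization

variable {E : Type*} [NormedAddCommGroup E] [NormedSpace ℝ E] {H : Type*} [TopologicalSpace H]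
  {I : ModelWithCorners ℝ E H} {M : Type*} [TopologicalSpace M] [ChartedSpace H M]
  [IsManifold I 1 M]

/-- The fibre coordinate of the preferred trivialization of the tangent bundle is the derivative of
the preferred chart. -/
theorem trivializationAt_apply_snd {q b : M} (hb : b ∈ (chartAt H q).source)
    (w : TangentSpace I b) :
    (trivializationAt E (TangentSpace I) q ⟨b, w⟩).2 =
      mfderiv I 𝓘(ℝ, E) (extChartAt I q) b w := by
  have h1 : (trivializationAt E (TangentSpace I) q).continuousLinearMapAt ℝ b w =
      mfderiv I 𝓘(ℝ, E) (extChartAt I q) b w :=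
    congrArg (fun L : TangentSpace I b →L[ℝ] E => L w)
      (TangentBundle.continuousLinearMapAt_trivializationAt (I := I) hb)
  rw [← h1, Bundle.Trivialization.continuousLinearMapAt_apply,
    Bundle.Trivialization.coe_linearMapAt_of_mem _ (by simpa using hb)]

end Trivialization

section Projection

variable {n : ℕ} {M : Type*} [TopologicalSpace M] [ChartedSpace (EuclideanSpace ℝ (Fin n)) M]

local notation "𝔼" => EuclideanSpace ℝ (Fin n)

variable [IsManifold (𝓡 n) ∞ M] {T : EReal} {u₀ : M → ℝ} {x : ℝ → M → ℝ × M}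
  {σ : ∀ q : M, TangentSpace (𝓡 n) q →L[ℝ] TangentSpace (𝓡 n) q →L[ℝ] ℝ}
  {ν : ∀ (t : ℝ) (p : M), TangentSpace (coneModel n) (x t p)}

theorem IsSolution.continuousOn (hx : IsSolution σ T u₀ x ν) :
    ContinuousOn (fun z : ℝ × M => x z.1 z.2) (timeInterval T ×ˢ univ) :=
  (FiberBundle.continuous_proj (ℝ × 𝔼) (TangentSpace (coneModel n) (M := ℝ × M))).comp_continuousOn
    hx.normal_continuous

theorem IsSolution.continuousOn_normal_fst (hx : IsSolution σ T u₀ x ν) :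
    ContinuousOn (fun z : ℝ × M => (tangentCoord (ν z.1 z.2)).1) (timeInterval T ×ˢ univ) := by
  have : IsManifold (𝓡 n) 1 M := .of_le (n := ∞) (by simp)
  have h1 : Continuous (tangentMap (coneModel n) 𝓘(ℝ, ℝ) (Prod.fst : ℝ × M → ℝ)) :=
    (contMDiff_fst (n := 1)).continuous_tangentMap le_rfl
  have h2 : Continuous (fun w : TangentBundle 𝓘(ℝ, ℝ) ℝ =>
    (tangentBundleModelSpaceHomeomorph 𝓘(ℝ, ℝ) w).2) :=
    continuous_snd.comp (tangentBundleModelSpaceHomeomorph 𝓘(ℝ, ℝ)).continuous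
  refine ((h2.comp h1).comp_continuousOn hx.normal_continuous).congr fun z _ => ?_
  simp only [Function.comp_apply, tangentBundleModelSpaceHomeomorph_coe, tangentMap, mfderiv_fst]
  rfl

theorem IsSolution.mdifferentiableAt_of_contMDiff (hx : IsSolution σ T u₀ x ν)
    (hu₀ : ContMDiff (𝓡 n) 𝓘(ℝ, ℝ) 2 u₀) {t : ℝ} (ht : t ∈ timeInterval T) (p : M) :
    MDifferentiableAt (𝓡 n) (coneModel n) (x t) p := by
  rcases ht.1.eq_or_lt with h | h
  · subst h
    have e : x 0 = fun p => (u₀ p, p) := funext hx.initial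
    rw [e]
    exact ((hu₀ p).mdifferentiableAt two_ne_zero).prodMk mdifferentiableAt_id
  · exact hx.mdifferentiableAt ht h p

/-- Where the normal has a positive radial component, a tangent vector without horizontal component
vanishes: it is a multiple of `∂_r`, and orthogonal to the normal. -/
theorem IsSolution.injective_snd_mfderiv (hx : IsSolution σ T u₀ x ν) {t : ℝ}
    (ht : t ∈ timeInterval T) {p : M} (hpos : 0 < (tangentCoord (ν t p)).1)
    (v : TangentSpace (𝓡 n) p)
    (hv : (tangentCoord (mfderiv (𝓡 n) (coneModel n) (x t) p v)).2 = 0) : v = 0 := by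
  have h := hx.normal_orthogonal t ht p v
  rw [warpedMetric_apply, hv] at h
  have h1 : (tangentCoord (mfderiv (𝓡 n) (coneModel n) (x t) p v)).1 = 0 := by
    have h0 : σ (x t p).2 (0 : TangentSpace (𝓡 n) (x t p).2) (tangentCoord (ν t p)).2 = 0 := by
      rw [map_zero]; rfl
    have : (tangentCoord (mfderiv (𝓡 n) (coneModel n) (x t) p v)).1 * (tangentCoord (ν t p)).1 +
        (x t p).1 ^ 2 * σ (x t p).2 (0 : TangentSpace (𝓡 n) (x t p).2) (tangentCoord (ν t p)).2 = 0
          := h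
    rw [h0, mul_zero, add_zero] at this
    exact (mul_eq_zero.mp this).resolve_right hpos.ne'
  have h2 : mfderiv (𝓡 n) (coneModel n) (x t) p v = mfderiv (𝓡 n) (coneModel n) (x t) p 0 := by
    rw [map_zero]
    exact Prod.ext h1 hv
  exact hx.immersion t ht p h2

/-- The radial projection `snd ∘ x t`, in the preferred charts at `p₀` and at its image at time
`t₀`. -/
def projChart (x : ℝ → M → ℝ × M) (t₀ : ℝ) (p₀ : M) (t : ℝ) (y : 𝔼) : 𝔼 :=
    (flowChart x t₀ p₀ (t, y)).2

theorem IsSolution.hasFDerivAt_projChart (hx : IsSolution σ T u₀ x ν)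
    (hu₀ : ContMDiff (𝓡 n) 𝓘(ℝ, ℝ) 2 u₀) {t t₀ : ℝ} (ht : t ∈ timeInterval T) {p₀ : M} {y : 𝔼}
    (hy : y ∈ (extChartAt (𝓡 n) p₀).target)
    (hxy : (x t ((extChartAt (𝓡 n) p₀).symm y)).2 ∈ (extChartAt (𝓡 n) (x t₀ p₀).2).source) :
    ∃ L : 𝔼 →L[ℝ] 𝔼, HasFDerivAt (projChart x t₀ p₀ t) L y ∧ ∀ v,
      L v = mfderiv (𝓡 n) 𝓘(ℝ, 𝔼) (extChartAt (𝓡 n) (x t₀ p₀).2)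
        (x t ((extChartAt (𝓡 n) p₀).symm y)).2
        (tangentCoord (mfderiv (𝓡 n) (coneModel n) (x t) ((extChartAt (𝓡 n) p₀).symm y)
          (mfderiv 𝓘(ℝ, 𝔼) (𝓡 n) (extChartAt (𝓡 n) p₀).symm y v))).2 := by
  have : IsManifold (𝓡 n) 1 M := .of_le (n := ∞) (by simp)
  have h1 : MDifferentiableAt 𝓘(ℝ, 𝔼) (𝓡 n) (extChartAt (𝓡 n) p₀).symm y := by
    have := mdifferentiableWithinAt_extChartAt_symm (I := 𝓡 n) hy
    rwa [ModelWithCorners.range_eq_univ, mdifferentiableWithinAt_univ] at this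
  have h2 := hx.mdifferentiableAt_of_contMDiff hu₀ ht ((extChartAt (𝓡 n) p₀).symm y)
  have h3 : MDifferentiableAt (𝓡 n) 𝓘(ℝ, 𝔼) (extChartAt (𝓡 n) (x t₀ p₀).2)
      (x t ((extChartAt (𝓡 n) p₀).symm y)).2 :=
    mdifferentiableAt_extChartAt (by rwa [extChartAt_source] at hxy)
  have h4 := HasMFDerivAt.comp y h3.hasMFDerivAt (HasMFDerivAt.comp y (hasMFDerivAt_snd _)
    (HasMFDerivAt.comp y h2.hasMFDerivAt h1.hasMFDerivAt))
  exact ⟨_, hasMFDerivAt_iff_hasFDerivAt.mp h4, fun v => rfl⟩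

theorem IsSolution.eventually_chart (hx : IsSolution σ T u₀ x ν) {t₀ : ℝ}
    (ht₀ : t₀ ∈ timeInterval T) (p₀ : M) :
    ∀ᶠ a in 𝓝[timeInterval T ×ˢ univ] (t₀, extChartAt (𝓡 n) p₀ p₀),
      a.2 ∈ (extChartAt (𝓡 n) p₀).target ∧
      (x a.1 ((extChartAt (𝓡 n) p₀).symm a.2)).2 ∈ (extChartAt (𝓡 n) (x t₀ p₀).2).source := by
  have h1 : ∀ᶠ a : ℝ × 𝔼 in 𝓝 (t₀, extChartAt (𝓡 n) p₀ p₀), a.2 ∈ (extChartAt (𝓡 n) p₀).target :=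
    (continuousAt_snd (p := (t₀, extChartAt (𝓡 n) p₀ p₀))).eventually
      (extChartAt_target_mem_nhds (I := 𝓡 n) p₀)
  have h2 : ContinuousWithinAt (fun a : ℝ × 𝔼 => (x a.1 ((extChartAt (𝓡 n) p₀).symm a.2)).2)
      (timeInterval T ×ˢ univ) (t₀, extChartAt (𝓡 n) p₀ p₀) := by
    have e : ContinuousAt (fun a : ℝ × 𝔼 => (a.1, (extChartAt (𝓡 n) p₀).symm a.2))
        (t₀, extChartAt (𝓡 n) p₀ p₀) :=
      continuousAt_fst.prodMk (ContinuousAt.comp_of_eq (continuousAt_extChartAt_symm p₀)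
        continuousAt_snd rfl)
    have hc := hx.continuousOn (t₀, p₀) ⟨ht₀, mem_univ _⟩
    have h3 := ContinuousWithinAt.comp_of_eq (t := timeInterval T ×ˢ univ) hc
      e.continuousWithinAt (s := timeInterval T ×ˢ univ) (fun a ha => ⟨ha.1, mem_univ _⟩) (by simp)
    exact continuous_snd.continuousAt.comp_continuousWithinAt h3
  refine (h1.filter_mono nhdsWithin_le_nhds).and (h2.eventually ?_)
  simp only [extChartAt_to_inv]
  exact extChartAt_source_mem_nhds _

/-- The derivative of the radial projection is jointly continuous in time and space. -/
theorem IsSolution.continuousWithinAt_fderiv_projChart (hx : IsSolution σ T u₀ x ν)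
    (hu₀ : ContMDiff (𝓡 n) 𝓘(ℝ, ℝ) 2 u₀) {t₀ : ℝ} (ht₀ : t₀ ∈ timeInterval T) (p₀ : M) :
    ContinuousWithinAt (fun a : ℝ × 𝔼 => fderiv ℝ (projChart x t₀ p₀ a.1) a.2)
      (timeInterval T ×ˢ univ) (t₀, extChartAt (𝓡 n) p₀ p₀) := by
  have : IsManifold (𝓡 n) 1 M := .of_le (n := ∞) (by simp)
  rw [continuousWithinAt_clm_apply]
  intro v
  set e₀ := trivializationAt 𝔼 (TangentSpace (𝓡 n)) p₀
  set e₁ := trivializationAt 𝔼 (TangentSpace (𝓡 n)) (x t₀ p₀).2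
  let w : ℝ × 𝔼 → TangentBundle (𝓡 n) M := fun a =>
    e₀.toOpenPartialHomeomorph.symm ((extChartAt (𝓡 n) p₀).symm a.2, v)
  let G : ℝ × 𝔼 → TangentBundle (𝓡 n) M := fun a =>
    tangentMap (coneModel n) (𝓡 n) Prod.snd (tangentMap (𝓡 n) (coneModel n) (x a.1) (w a))
  have hp₀ : p₀ ∈ e₀.baseSet := FiberBundle.mem_baseSet_trivializationAt' p₀
  have hw : ContinuousAt w (t₀, extChartAt (𝓡 n) p₀ p₀) := by
    have h1 : ContinuousAt (fun a : ℝ × 𝔼 => ((extChartAt (𝓡 n) p₀).symm a.2, v))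
        (t₀, extChartAt (𝓡 n) p₀ p₀) :=
      (ContinuousAt.comp_of_eq (continuousAt_extChartAt_symm p₀) continuousAt_snd rfl).prodMk
        continuousAt_const
    refine ContinuousAt.comp_of_eq (y := (p₀, v)) ?_ h1 (by simp)
    exact e₀.toOpenPartialHomeomorph.continuousAt_symm (by simp [e₀])
  have hproj : ∀ a : ℝ × 𝔼, a.2 ∈ (extChartAt (𝓡 n) p₀).target →
      w a = ⟨(extChartAt (𝓡 n) p₀).symm a.2,
        mfderiv 𝓘(ℝ, 𝔼) (𝓡 n) (extChartAt (𝓡 n) p₀).symm a.2 v⟩ := by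
    intro a ha
    have hb : (extChartAt (𝓡 n) p₀).symm a.2 ∈ e₀.baseSet := by
      have := (extChartAt (𝓡 n) p₀).map_target ha
      rw [extChartAt_source] at this
      simpa [e₀] using this
    rw [← trivializationAt_symm_apply ha, Bundle.Trivialization.mk_symm _ hb]
  have hG : ContinuousWithinAt G (timeInterval T ×ˢ univ) (t₀, extChartAt (𝓡 n) p₀ p₀) := by
    have h1 : Continuous (tangentMap (coneModel n) (𝓡 n) (Prod.snd : ℝ × M → M)) :=
      (contMDiff_snd (n := 1)).continuous_tangentMap le_rfl
    have h2 := hx.continuous_tangentMap (t₀, w (t₀, extChartAt (𝓡 n) p₀ p₀)) ⟨ht₀, mem_univ _⟩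
    have h3 : ContinuousAt (fun a : ℝ × 𝔼 => (a.1, w a)) (t₀, extChartAt (𝓡 n) p₀ p₀) :=
      continuousAt_fst.prodMk hw
    exact h1.continuousAt.comp_continuousWithinAt (ContinuousWithinAt.comp_of_eq
      (t := timeInterval T ×ˢ univ) h2 h3.continuousWithinAt (s := timeInterval T ×ˢ univ)
      (fun a ha => ⟨ha.1, mem_univ _⟩) rfl)
  have hGe : ContinuousWithinAt (fun a => (e₁ (G a)).2) (timeInterval T ×ˢ univ)
      (t₀, extChartAt (𝓡 n) p₀ p₀) := by
    refine continuous_snd.continuousAt.comp_continuousWithinAt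
      (ContinuousAt.comp_continuousWithinAt ?_ hG)
    refine e₁.continuousOn.continuousAt (e₁.open_source.mem_nhds ?_)
    rw [e₁.mem_source]
    have : (G (t₀, extChartAt (𝓡 n) p₀ p₀)).proj = (x t₀ p₀).2 := by
      simp only [G, tangentMap]
      rw [hproj (t₀, extChartAt (𝓡 n) p₀ p₀) (mem_extChartAt_target p₀)]
      simp
    rw [this]
    exact FiberBundle.mem_baseSet_trivializationAt' _
  have heq : ∀ᶠ a in 𝓝[timeInterval T ×ˢ univ] (t₀, extChartAt (𝓡 n) p₀ p₀),
      fderiv ℝ (projChart x t₀ p₀ a.1) a.2 v = (e₁ (G a)).2 := by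
    filter_upwards [hx.eventually_chart ht₀ p₀, self_mem_nhdsWithin] with a ha haJ
    obtain ⟨L, hL, hLv⟩ := hx.hasFDerivAt_projChart hu₀ haJ.1 ha.1 ha.2
    rw [hL.fderiv, hLv]
    have hb : (x a.1 ((extChartAt (𝓡 n) p₀).symm a.2)).2 ∈ (chartAt 𝔼 (x t₀ p₀).2).source := by
      have := ha.2
      rwa [extChartAt_source] at this
    refine (trivializationAt_apply_snd hb _).symm.trans ?_
    have hGa : G a = tangentMap (coneModel n) (𝓡 n) Prod.snd (tangentMap (𝓡 n) (coneModel n)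
        (x a.1) ⟨(extChartAt (𝓡 n) p₀).symm a.2,
          mfderiv 𝓘(ℝ, 𝔼) (𝓡 n) (extChartAt (𝓡 n) p₀).symm a.2 v⟩) :=
      congrArg (fun b => tangentMap (coneModel n) (𝓡 n) (Prod.snd : ℝ × M → M)
        (tangentMap (𝓡 n) (coneModel n) (x a.1) b)) (hproj a ha.1)
    rw [hGa]
    simp only [tangentMap, mfderiv_snd]
    rfl
  exact hGe.congr_of_eventuallyEq heq (heq.self_of_nhdsWithin ⟨ht₀, mem_univ _⟩)

theorem IsSolution.bijective_fderiv_projChart (hx : IsSolution σ T u₀ x ν)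
    (hu₀ : ContMDiff (𝓡 n) 𝓘(ℝ, ℝ) 2 u₀) {t₀ : ℝ} (ht₀ : t₀ ∈ timeInterval T) (p₀ : M)
    (hpos : 0 < (tangentCoord (ν t₀ p₀)).1) :
    Function.Bijective (fderiv ℝ (projChart x t₀ p₀ t₀) (extChartAt (𝓡 n) p₀ p₀)) := by
  have hinj : Function.Injective
      (fderiv ℝ (projChart x t₀ p₀ t₀) (extChartAt (𝓡 n) p₀ p₀) : 𝔼 →ₗ[ℝ] 𝔼) := by
    rw [← LinearMap.ker_eq_bot, LinearMap.ker_eq_bot']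
    intro v hv
    have hmd := hx.mdifferentiableAt_of_contMDiff hu₀ ht₀ p₀
    have hd : DifferentiableAt ℝ (fun y => flowChart x t₀ p₀ (t₀, y)) (extChartAt (𝓡 n) p₀ p₀) := by
      rw [flowChart_slice]
      have := hmd.differentiableWithinAt_writtenInExtChartAt
      rwa [ModelWithCorners.range_eq_univ, differentiableWithinAt_univ] at this
    have h2 : HasFDerivAt (projChart x t₀ p₀ t₀) ((ContinuousLinearMap.snd ℝ ℝ 𝔼).comp
        (fderiv ℝ (fun y => flowChart x t₀ p₀ (t₀, y)) (extChartAt (𝓡 n) p₀ p₀)))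
        (extChartAt (𝓡 n) p₀ p₀) :=
      (ContinuousLinearMap.snd ℝ ℝ 𝔼).hasFDerivAt.comp _ hd.hasFDerivAt
    apply hx.injective_snd_mfderiv ht₀ hpos v
    rw [← fderiv_flowChart hmd]
    have h3 := hv
    rw [h2.fderiv] at h3
    exact h3
  exact ⟨hinj, LinearMap.injective_iff_surjective.mp hinj⟩

/-- The radial projections are injective near `p₀`, and cover a neighbourhood of the image of `p₀`,
uniformly for times near `t₀`. -/
theorem IsSolution.exists_local_inverse (hx : IsSolution σ T u₀ x ν)
    (hu₀ : ContMDiff (𝓡 n) 𝓘(ℝ, ℝ) 2 u₀) {t₀ : ℝ} (ht₀ : t₀ ∈ timeInterval T) (p₀ : M)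
    (hpos : 0 < (tangentCoord (ν t₀ p₀)).1) :
    (∃ V ∈ 𝓝 p₀, ∀ᶠ t in 𝓝[timeInterval T] t₀, InjOn (fun p => (x t p).2) V) ∧
      ∀ W ∈ 𝓝 p₀, ∃ Q ∈ 𝓝 (x t₀ p₀).2, ∀ᶠ t in 𝓝[timeInterval T] t₀,
        Q ⊆ (fun p => (x t p).2) '' W := by
  have hchart := hx.eventually_chart ht₀ p₀
  have hd : ∀ᶠ a in 𝓝[timeInterval T ×ˢ univ] (t₀, extChartAt (𝓡 n) p₀ p₀),
      DifferentiableAt ℝ (projChart x t₀ p₀ a.1) a.2 := by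
    filter_upwards [hchart, self_mem_nhdsWithin] with a ha haJ
    obtain ⟨L, hL, -⟩ := hx.hasFDerivAt_projChart hu₀ haJ.1 ha.1 ha.2
    exact hL.differentiableAt
  have hself : projChart x t₀ p₀ t₀ (extChartAt (𝓡 n) p₀ p₀) =
      extChartAt (𝓡 n) (x t₀ p₀).2 (x t₀ p₀).2 := by
    simp [projChart, flowChart]
  have hc : ContinuousWithinAt (fun t => projChart x t₀ p₀ t (extChartAt (𝓡 n) p₀ p₀))
      (timeInterval T) t₀ := by
    have h1 := (hx.hasDerivWithinAt_flowChart ht₀ p₀).continuousWithinAt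
    exact continuous_snd.continuousAt.comp_continuousWithinAt h1
  obtain ⟨δ, hδ, hinj, himage⟩ := exists_ball_injOn_and_image hd
    (hx.continuousWithinAt_fderiv_projChart hu₀ ht₀ p₀) hc
    (hx.bijective_fderiv_projChart hu₀ ht₀ p₀ hpos)
  rw [nhdsWithin_prod_eq, nhdsWithin_univ, Filter.eventually_prod_iff] at hchart
  obtain ⟨pa, hpa, pb, hpb, hab⟩ := hchart
  obtain ⟨η, hη, hball⟩ := Metric.eventually_nhds_iff_ball.mp hpb
  constructor
  · refine ⟨(extChartAt (𝓡 n) p₀).source ∩ extChartAt (𝓡 n) p₀ ⁻¹' Metric.ball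
      (extChartAt (𝓡 n) p₀ p₀) δ, Filter.inter_mem (extChartAt_source_mem_nhds p₀)
      ((continuousAt_extChartAt p₀).preimage_mem_nhds (Metric.ball_mem_nhds _ hδ)), ?_⟩
    filter_upwards [hinj] with t ht p hp p' hp' hpp'
    refine (extChartAt (𝓡 n) p₀).injOn hp.1 hp'.1 (ht hp.2 hp'.2 ?_)
    simp only [projChart, flowChart, (extChartAt (𝓡 n) p₀).left_inv hp.1,
      (extChartAt (𝓡 n) p₀).left_inv hp'.1]
    exact congrArg _ hpp'
  · intro W hW
    have hW' : (extChartAt (𝓡 n) p₀).symm ⁻¹' W ∈ 𝓝 (extChartAt (𝓡 n) p₀ p₀) :=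
      (continuousAt_extChartAt_symm p₀).preimage_mem_nhds (by simpa using hW)
    obtain ⟨η', hη', hballW⟩ := Metric.mem_nhds_iff.mp hW'
    set ε := min δ (min η η') / 2 with hε
    have hε0 : 0 < min δ (min η η') := lt_min hδ (lt_min hη hη')
    have hεδ : ε < δ := (half_lt_self hε0).trans_le (min_le_left _ _)
    have hεη : ε < η := (half_lt_self hε0).trans_le ((min_le_right _ _).trans (min_le_left _ _))
    have hεη' : ε < η' := (half_lt_self hε0).trans_le ((min_le_right _ _).trans (min_le_right _ _))
    obtain ⟨r, hr, hrt⟩ := himage ε (by positivity) hεδ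
    rw [hself] at hrt
    refine ⟨(extChartAt (𝓡 n) (x t₀ p₀).2).source ∩ extChartAt (𝓡 n) (x t₀ p₀).2 ⁻¹'
      Metric.closedBall (extChartAt (𝓡 n) (x t₀ p₀).2 (x t₀ p₀).2) r,
      Filter.inter_mem (extChartAt_source_mem_nhds _)
        ((continuousAt_extChartAt _).preimage_mem_nhds (Metric.closedBall_mem_nhds _ hr)), ?_⟩
    filter_upwards [hrt, hpa] with t ht hta q hq
    obtain ⟨y, hy, hyq⟩ := ht hq.2
    refine ⟨(extChartAt (𝓡 n) p₀).symm y,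
      hballW (Metric.closedBall_subset_ball hεη' hy), ?_⟩
    exact (extChartAt (𝓡 n) (x t₀ p₀).2).injOn
      (hab hta (hball y (Metric.closedBall_subset_ball hεη hy))).2 hq.1 hyq

end Projection

/-! ### Global bijectivity of the radial projection -/

section Bijectivity

/-- In a continuous family of self-maps of a compact Hausdorff space that are locally injective and
open, both uniformly in the parameter, bijectivity propagates along an interval. -/
theorem bijective_of_locally_injOn_of_locally_open {M : Type*} [TopologicalSpace M] [T2Space M]
    [CompactSpace M] {P : ℝ → M → M} {J : Set ℝ} (hJ : IsPreconnected J)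
    (hc : ContinuousOn (fun z : ℝ × M => P z.1 z.2) (J ×ˢ univ))
    (hI : ∀ t ∈ J, ∀ p, ∃ V ∈ 𝓝 p, ∀ᶠ s in 𝓝[J] t, InjOn (P s) V)
    (hO : ∀ t ∈ J, ∀ p, ∀ W ∈ 𝓝 p, ∃ Q ∈ 𝓝 (P t p), ∀ᶠ s in 𝓝[J] t, Q ⊆ P s '' W)
    {t₀ : ℝ} (ht₀ : t₀ ∈ J) (h₀ : Function.Bijective (P t₀)) {t : ℝ} (ht : t ∈ J) :
    Function.Bijective (P t) := by
  have hcont : ∀ {s : ℝ}, s ∈ J → ∀ p, Tendsto (fun z : ℝ × M => P z.1 z.2)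
      (𝓝[J] s ×ˢ 𝓝 p) (𝓝 (P s p)) := by
    intro s hs p
    have := hc (s, p) ⟨hs, mem_univ _⟩
    rwa [ContinuousWithinAt, nhdsWithin_prod_eq, nhdsWithin_univ] at this
  -- injectivity is a closed and open condition on the parameter
  have hinj : ∀ s ∈ J, ∀ᶠ s' in 𝓝[J] s,
      (Function.Injective (P s) ↔ Function.Injective (P s')) := by
    intro s hs
    by_cases h : Function.Injective (P s)
    · have key : ∀ᶠ s' in 𝓝 s, ∀ a ∈ (univ : Set (M × M)), s' ∈ J → P s' a.1 = P s' a.2 →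
          a.1 = a.2 := by
        refine isCompact_univ.eventually_forall_of_forall_eventually ?_
        rintro ⟨p, p'⟩ -
        by_cases hpp : p = p'
        · subst hpp
          obtain ⟨V, hV, hs'⟩ := hI s hs p
          rw [nhdsWithin, eventually_inf_principal] at hs'
          rw [nhds_prod_eq, nhds_prod_eq]
          filter_upwards [hs'.prod_mk (prod_mem_prod hV hV)] with z hz hzJ hzz
          exact hz.1 hzJ hz.2.1 hz.2.2 hzz
        · obtain ⟨U, U', hU, hU', hpU, hpU', hd⟩ := t2_separation (h.ne hpp)
          have h1 := (hcont hs p).eventually (hU.mem_nhds hpU)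
          have h2 := (hcont hs p').eventually (hU'.mem_nhds hpU')
          have t1 : Tendsto (fun z : ℝ × M × M => (z.1, z.2.1)) (𝓝[J] s ×ˢ 𝓝 p ×ˢ 𝓝 p')
              (𝓝[J] s ×ˢ 𝓝 p) := tendsto_fst.prodMk (tendsto_fst.comp tendsto_snd)
          have t2 : Tendsto (fun z : ℝ × M × M => (z.1, z.2.2)) (𝓝[J] s ×ˢ 𝓝 p ×ˢ 𝓝 p')
              (𝓝[J] s ×ˢ 𝓝 p') := tendsto_fst.prodMk (tendsto_snd.comp tendsto_snd)
          have h3 := (t1.eventually h1).and (t2.eventually h2)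
          have e : (𝓝[J] s ×ˢ 𝓝 p ×ˢ 𝓝 p' : Filter (ℝ × M × M)) =
              𝓝[J ×ˢ univ] (s, (p, p')) := by
            rw [nhdsWithin_prod_eq, nhdsWithin_univ, nhds_prod_eq]
          rw [e, nhdsWithin, eventually_inf_principal] at h3
          filter_upwards [h3] with z hz hzJ hzz
          have := hz ⟨hzJ, mem_univ _⟩
          exact absurd hzz (hd.ne_of_mem this.1 this.2)
      rw [nhdsWithin, eventually_inf_principal]
      filter_upwards [key] with s' hs' hs'J
      exact iff_of_true h fun a a' haa => hs' (a, a') (mem_univ _) hs'J haa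
    · have h' := h
      simp only [Function.Injective, not_forall] at h'
      obtain ⟨p, p', hpp, hne⟩ := h'
      obtain ⟨W, W', hW, hW', hpW, hpW', hd⟩ := t2_separation hne
      obtain ⟨Q, hQ, h1⟩ := hO s hs p W (hW.mem_nhds hpW)
      obtain ⟨Q', hQ', h2⟩ := hO s hs p' W' (hW'.mem_nhds hpW')
      filter_upwards [h1, h2] with s' h1 h2
      refine iff_of_false h fun hi => ?_
      obtain ⟨a, ha, haq⟩ := h1 (mem_of_mem_nhds hQ)
      obtain ⟨a', ha', haq'⟩ := h2 (mem_of_mem_nhds hQ')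
      exact hd.ne_of_mem ha ha' (hi (haq.trans (hpp.trans haq'.symm)))
  -- and so is the condition that a given point is in the image
  have hsurj : ∀ q, ∀ s ∈ J, ∀ᶠ s' in 𝓝[J] s, (q ∈ range (P s) ↔ q ∈ range (P s')) := by
    intro q s hs
    by_cases h : q ∈ range (P s)
    · obtain ⟨p, rfl⟩ := h
      obtain ⟨Q, hQ, h1⟩ := hO s hs p univ univ_mem
      filter_upwards [h1] with s' h1
      refine iff_of_true ⟨p, rfl⟩ ?_
      obtain ⟨a, -, ha⟩ := h1 (mem_of_mem_nhds hQ)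
      exact ⟨a, ha⟩
    · have key : ∀ᶠ s' in 𝓝 s, ∀ a ∈ (univ : Set M), s' ∈ J → P s' a ≠ q := by
        refine isCompact_univ.eventually_forall_of_forall_eventually fun p _ => ?_
        have h1 := (hcont hs p).eventually (isOpen_ne.mem_nhds fun hq => h ⟨p, hq⟩)
        have e : (𝓝[J] s ×ˢ 𝓝 p : Filter (ℝ × M)) = 𝓝[J ×ˢ univ] (s, p) := by
          rw [nhdsWithin_prod_eq, nhdsWithin_univ]
        rw [e, nhdsWithin, eventually_inf_principal] at h1
        filter_upwards [h1] with z hz hzJ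
        exact hz ⟨hzJ, mem_univ _⟩
      rw [nhdsWithin, eventually_inf_principal]
      filter_upwards [key] with s' hs' hs'J
      exact iff_of_false h fun ⟨a, ha⟩ => hs' a (mem_univ _) hs'J ha
  constructor
  · exact (hJ.induction₂ (fun s s' => Function.Injective (P s) ↔ Function.Injective (P s')) hinj
      (fun _ _ _ _ _ _ h h' => h.trans h') (fun _ _ _ _ h => h.symm) ht₀ ht).mp h₀.1
  · intro q
    exact (hJ.induction₂ (fun s s' => q ∈ range (P s) ↔ q ∈ range (P s')) (hsurj q)
      (fun _ _ _ _ _ _ h h' => h.trans h') (fun _ _ _ _ h => h.symm) ht₀ ht).mp (h₀.2 q)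

variable {n : ℕ} {M : Type*} [TopologicalSpace M] [ChartedSpace (EuclideanSpace ℝ (Fin n)) M]

local notation "𝔼" => EuclideanSpace ℝ (Fin n)

variable [IsManifold (𝓡 n) ∞ M] {T : EReal} {u₀ : M → ℝ} {x : ℝ → M → ℝ × M}
  {σ : ∀ q : M, TangentSpace (𝓡 n) q →L[ℝ] TangentSpace (𝓡 n) q →L[ℝ] ℝ}
  {ν : ∀ (t : ℝ) (p : M), TangentSpace (coneModel n) (x t p)}

/-- As long as the normal has a positive radial component, the hypersurfaces are graphs. -/
theorem IsSolution.bijective_snd [T2Space M] [CompactSpace M] (hx : IsSolution σ T u₀ x ν)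
    (hu₀ : ContMDiff (𝓡 n) 𝓘(ℝ, ℝ) 2 u₀) {t : ℝ} (ht : t ∈ timeInterval T)
    (hpos : ∀ s ∈ Icc 0 t, ∀ p, 0 < (tangentCoord (ν s p)).1) :
    Function.Bijective fun p => (x t p).2 := by
  have hsub : Icc 0 t ⊆ timeInterval T := fun s hs =>
    ⟨hs.1, (EReal.coe_le_coe_iff.mpr hs.2).trans_lt ht.2⟩
  refine bijective_of_locally_injOn_of_locally_open (P := fun t p => (x t p).2)
    (isPreconnected_Icc (a := 0) (b := t)) ?_ ?_ ?_ (left_mem_Icc.mpr ht.1) ?_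
    (right_mem_Icc.mpr ht.1)
  · exact continuous_snd.comp_continuousOn
      (hx.continuousOn.mono (prod_mono hsub Subset.rfl))
  · intro s hs p
    obtain ⟨V, hV, h⟩ := (hx.exists_local_inverse hu₀ (hsub hs) p (hpos s hs p)).1
    exact ⟨V, hV, h.filter_mono (nhdsWithin_mono _ hsub)⟩
  · intro s hs p W hW
    obtain ⟨Q, hQ, h⟩ := (hx.exists_local_inverse hu₀ (hsub hs) p (hpos s hs p)).2 W hW
    exact ⟨Q, hQ, h.filter_mono (nhdsWithin_mono _ hsub)⟩
  · have : (fun p => (x 0 p).2) = id := funext fun p => by rw [hx.initial]; rfl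
    simp only [this]
    exact Function.bijective_id

end Bijectivity

/-! ### Regularity of the graph function -/

section LogRadius

/-- A smooth map `(t, y) ↦ (t, P (t, y))` whose slice at time `t` has a bijective derivative has a
smooth local right inverse. -/
theorem exists_contDiffAt_rightInverse {E : Type*} [NormedAddCommGroup E] [NormedSpace ℝ E]
    [FiniteDimensional ℝ E] {P : ℝ × E → E} {t : ℝ} {y : E} {k : WithTop ℕ∞} (hk : k ≠ 0)
    (hP : ContDiffAt ℝ k P (t, y)) (hbij : Function.Bijective (fderiv ℝ (fun y => P (t, y)) y)) :
    ∃ g : ℝ × E → E, g (t, P (t, y)) = y ∧ ContDiffAt ℝ k g (t, P (t, y)) ∧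
      ∀ᶠ a in 𝓝 (t, P (t, y)), P (a.1, g a) = a.2 := by
  have : CompleteSpace E := FiniteDimensional.complete ℝ E
  set Ψ : ℝ × E → ℝ × E := fun a => (a.1, P a) with hΨ
  have hΨc : ContDiffAt ℝ k Ψ (t, y) := contDiffAt_fst.prodMk hP
  have hPd := hP.differentiableAt hk
  set L : (ℝ × E) →L[ℝ] (ℝ × E) := (ContinuousLinearMap.fst ℝ ℝ E).prod (fderiv ℝ P (t, y)) with hL
  have hΨd : HasFDerivAt Ψ L (t, y) := hasFDerivAt_fst.prodMk hPd.hasFDerivAt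
  have hslice : fderiv ℝ (fun y => P (t, y)) y = (fderiv ℝ P (t, y)).comp (.inr ℝ ℝ E) :=
    (HasFDerivAt.comp (g := P) y hPd.hasFDerivAt (hasFDerivAt_prodMk_right t y)).fderiv
  have hinj : Function.Injective (L : (ℝ × E) →ₗ[ℝ] (ℝ × E)) := by
    rw [← LinearMap.ker_eq_bot, LinearMap.ker_eq_bot']
    rintro ⟨s, v⟩ h
    have h' : (s, fderiv ℝ P (t, y) (s, v)) = ((0 : ℝ), (0 : E)) := h
    obtain ⟨rfl, h2⟩ := Prod.mk.inj h'
    have : fderiv ℝ (fun y => P (t, y)) y v = fderiv ℝ (fun y => P (t, y)) y 0 := by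
      rw [map_zero, hslice]
      exact h2
    rw [hbij.1 this]
    rfl
  set A : (ℝ × E) ≃L[ℝ] (ℝ × E) := (LinearEquiv.ofInjectiveEndo _ hinj).toContinuousLinearEquiv
  have hA : HasFDerivAt Ψ (A : (ℝ × E) →L[ℝ] (ℝ × E)) (t, y) := by
    have : (A : (ℝ × E) →L[ℝ] (ℝ × E)) = L := by ext v <;> rfl
    rw [this]
    exact hΨd
  have hst := hΨc.hasStrictFDerivAt' hA hk
  refine ⟨fun a => (hΨc.localInverse hA hk a).2, ?_, ?_, ?_⟩
  · exact congrArg Prod.snd (hΨc.localInverse_apply_image hA hk)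
  · exact (hΨc.to_localInverse hA hk).snd
  · filter_upwards [hst.eventually_right_inverse] with a ha
    have ha' : Ψ (hΨc.localInverse hA hk a) = a := ha
    have h1 : (hΨc.localInverse hA hk a).1 = a.1 := (Prod.ext_iff.mp ha').1
    have h2 : P (hΨc.localInverse hA hk a) = a.2 := (Prod.ext_iff.mp ha').2
    rw [← h1]
    exact h2

variable {n : ℕ} {M : Type*} [TopologicalSpace M] [ChartedSpace (EuclideanSpace ℝ (Fin n)) M]

local notation "𝔼" => EuclideanSpace ℝ (Fin n)

open Classical in
/-- The logarithm of the radius of the hypersurface `x t` over the point `q`. It is a well-defined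
function if `x t` is a graph; where no point of the hypersurface lies over `q`, its value is `0`. -/
def logRadius (x : ℝ → M → ℝ × M) (t : ℝ) (q : M) : ℝ :=
  if h : ∃ p, (x t p).2 = q then Real.log (x t h.choose).1 else 0

variable {x : ℝ → M → ℝ × M}

omit [TopologicalSpace M] [ChartedSpace (EuclideanSpace ℝ (Fin n)) M] in
theorem logRadius_snd {t : ℝ} (hinj : Function.Injective fun p => (x t p).2) (p : M) :
    logRadius x t (x t p).2 = Real.log (x t p).1 := by
  have h : ∃ p', (x t p').2 = (x t p).2 := ⟨p, rfl⟩
  rw [logRadius, dif_pos h]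
  exact congrArg (fun p => Real.log (x t p).1) (hinj h.choose_spec)

omit [TopologicalSpace M] [ChartedSpace (EuclideanSpace ℝ (Fin n)) M] in
theorem exp_logRadius {t : ℝ} (hinj : Function.Injective fun p => (x t p).2) {p : M}
    (hp : 0 < (x t p).1) : (x t p).1 = Real.exp (logRadius x t (x t p).2) := by
  rw [logRadius_snd hinj, Real.exp_log hp]

variable [IsManifold (𝓡 n) ∞ M] {T : EReal} {u₀ : M → ℝ}
  {σ : ∀ q : M, TangentSpace (𝓡 n) q →L[ℝ] TangentSpace (𝓡 n) q →L[ℝ] ℝ}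
  {ν : ∀ (t : ℝ) (p : M), TangentSpace (coneModel n) (x t p)}

/-- The logarithmic radius is twice differentiable in time and space, by the inverse function
    theorem
for the space-time map `(t, p) ↦ (t, (x t p).2)`. -/
theorem IsSolution.contDiffAt_logRadius (hx : IsSolution σ T u₀ x ν)
    (hu₀ : ContMDiff (𝓡 n) 𝓘(ℝ, ℝ) 2 u₀) {t : ℝ} (ht : t ∈ timeInterval T) (ht0 : 0 < t) (p : M)
    (hpos : 0 < (tangentCoord (ν t p)).1)
    (hinj : ∀ᶠ s in 𝓝 t, Function.Injective fun p => (x s p).2) :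
    ContDiffAt ℝ 2 (fun a : ℝ × 𝔼 => logRadius x a.1 ((extChartAt (𝓡 n) (x t p).2).symm a.2))
      (t, extChartAt (𝓡 n) (x t p).2 (x t p).2) := by
  have hX := (hx.contDiffAt_flowChart ht ht0 p).of_le (m := 2) (by norm_cast)
  have hself := flowChart_self (n := n) x t p
  obtain ⟨g, hg0, hg, hge⟩ := exists_contDiffAt_rightInverse (P := fun a => (flowChart x t p a).2)
    two_ne_zero hX.snd (hx.bijective_fderiv_projChart hu₀ ht p hpos)
  simp only [hself] at hg0 hg hge
  set z := extChartAt (𝓡 n) (x t p).2 (x t p).2 with hz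
  have hpair : ContDiffAt ℝ 2 (fun a : ℝ × 𝔼 => (a.1, g a)) (t, z) := contDiffAt_fst.prodMk hg
  have hval : ((t, z).1, g (t, z)) = (t, extChartAt (𝓡 n) p p) := by rw [hg0]
  have hcomp : ContDiffAt ℝ 2 (fun a : ℝ × 𝔼 => flowChart x t p (a.1, g a)) (t, z) :=
    ContDiffAt.comp (g := flowChart x t p) (t, z) (by rw [hval]; exact hX) hpair
  have hlog : ContDiffAt ℝ 2 (fun a : ℝ × 𝔼 => Real.log (flowChart x t p (a.1, g a)).1) (t, z) := by
    refine hcomp.fst.log (ne_of_gt ?_)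
    have : flowChart x t p ((t, z).1, g (t, z)) = ((x t p).1, z) := by rw [hval, hself]
    rw [this]
    exact hx.radius_pos t ht p
  refine hlog.congr_of_eventuallyEq ?_
  have h1 : ContinuousAt (fun a : ℝ × 𝔼 => (x a.1 ((extChartAt (𝓡 n) p).symm (g a))).2)
      (t, z) := by
    have h0 := (hx.contMDiffAt ht ht0 p).continuousAt
    have h2 : ContinuousAt (fun a : ℝ × 𝔼 => (a.1, (extChartAt (𝓡 n) p).symm (g a))) (t, z) :=
      continuousAt_fst.prodMk (ContinuousAt.comp_of_eq (continuousAt_extChartAt_symm p)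
        hg.continuousAt hg0)
    exact continuous_snd.continuousAt.comp (ContinuousAt.comp_of_eq h0 h2 (by simp [hg0]))
  have h2 : ∀ᶠ a : ℝ × 𝔼 in 𝓝 (t, z),
      (x a.1 ((extChartAt (𝓡 n) p).symm (g a))).2 ∈ (extChartAt (𝓡 n) (x t p).2).source := by
    apply h1.eventually
    simp only [hg0, extChartAt_to_inv]
    exact extChartAt_source_mem_nhds _
  have h3 : ∀ᶠ a : ℝ × 𝔼 in 𝓝 (t, z), Function.Injective fun p => (x a.1 p).2 :=
    (continuousAt_fst (p := (t, z))).eventually hinj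
  filter_upwards [hge, h2, h3] with a ha h2 h3
  have h4 : (extChartAt (𝓡 n) (x t p).2).symm a.2 =
      (x a.1 ((extChartAt (𝓡 n) p).symm (g a))).2 := by
    rw [← ha]
    exact (extChartAt (𝓡 n) (x t p).2).left_inv h2
  rw [h4, logRadius_snd h3]
  rfl

end LogRadius

section ChartFunctions

variable {n : ℕ} {M : Type*} [TopologicalSpace M] [ChartedSpace (EuclideanSpace ℝ (Fin n)) M]

local notation "𝔼" => EuclideanSpace ℝ (Fin n)

variable {φ : ℝ → M → ℝ} {t : ℝ} {q : M}

theorem contMDiffAt_slice {k : WithTop ℕ∞}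
    (hφ : ContDiffAt ℝ k (fun a : ℝ × 𝔼 => φ a.1 ((extChartAt (𝓡 n) q).symm a.2))
      (t, extChartAt (𝓡 n) q q)) : ContMDiffAt (𝓡 n) 𝓘(ℝ, ℝ) k (φ t) q := by
  rw [contMDiffAt_iff_source, ModelWithCorners.range_eq_univ, contMDiffWithinAt_univ,
    contMDiffAt_iff_contDiffAt]
  exact ContDiffAt.comp (g := fun a : ℝ × 𝔼 => φ a.1 ((extChartAt (𝓡 n) q).symm a.2)) _ hφ
    (contDiffAt_const.prodMk contDiffAt_id)

theorem continuousAt_of_chart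
    (hφ : ContinuousAt (fun a : ℝ × 𝔼 => φ a.1 ((extChartAt (𝓡 n) q).symm a.2))
      (t, extChartAt (𝓡 n) q q)) : ContinuousAt (fun z : ℝ × M => φ z.1 z.2) (t, q) := by
  have h1 : ContinuousAt (fun z : ℝ × M => (z.1, extChartAt (𝓡 n) q z.2)) (t, q) :=
    continuousAt_fst.prodMk (ContinuousAt.comp_of_eq (continuousAt_extChartAt q)
      continuousAt_snd rfl)
  refine (ContinuousAt.comp_of_eq hφ h1 rfl).congr ?_
  filter_upwards [continuousAt_snd.eventually (extChartAt_source_mem_nhds (I := 𝓡 n) q)] with z hz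
  exact congrArg (φ z.1) ((extChartAt (𝓡 n) q).left_inv hz)

theorem eventually_hasDerivAt_of_chart
    (hφ : ContDiffAt ℝ 1 (fun a : ℝ × 𝔼 => φ a.1 ((extChartAt (𝓡 n) q).symm a.2))
      (t, extChartAt (𝓡 n) q q)) :
    ∀ᶠ a : ℝ × 𝔼 in 𝓝 (t, extChartAt (𝓡 n) q q),
      HasDerivAt (fun s => φ s ((extChartAt (𝓡 n) q).symm a.2))
        (fderiv ℝ (fun a : ℝ × 𝔼 => φ a.1 ((extChartAt (𝓡 n) q).symm a.2)) a (1, 0)) a.1 := by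
  filter_upwards [hφ.eventually (by simp)] with a ha
  exact HasFDerivAt.comp_hasDerivAt (l := fun a : ℝ × 𝔼 => φ a.1 ((extChartAt (𝓡 n) q).symm a.2))
    a.1 (ha.differentiableAt one_ne_zero).hasFDerivAt
    ((hasDerivAt_id a.1).prodMk (hasDerivAt_const a.1 a.2))

theorem differentiableAt_time_of_chart
    (hφ : ContDiffAt ℝ 1 (fun a : ℝ × 𝔼 => φ a.1 ((extChartAt (𝓡 n) q).symm a.2))
      (t, extChartAt (𝓡 n) q q)) : DifferentiableAt ℝ (fun s => φ s q) t := by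
  have := (eventually_hasDerivAt_of_chart hφ).self_of_nhds.differentiableAt
  simpa using this

theorem continuousAt_deriv_time_of_chart
    (hφ : ContDiffAt ℝ 1 (fun a : ℝ × 𝔼 => φ a.1 ((extChartAt (𝓡 n) q).symm a.2))
      (t, extChartAt (𝓡 n) q q)) :
    ContinuousAt (fun z : ℝ × M => deriv (fun s => φ s z.2) z.1) (t, q) := by
  refine continuousAt_of_chart (n := n) (φ := fun t q => deriv (fun s => φ s q) t) ?_
  have h1 := ((hφ.fderiv_right (m := 0) (by norm_num)).continuousAt).clm_apply
    (continuousAt_const (y := ((1 : ℝ), (0 : 𝔼))))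
  refine h1.congr ?_
  filter_upwards [eventually_hasDerivAt_of_chart hφ] with a ha
  exact ha.deriv.symm

end ChartFunctions

/-! ### The maximum principle -/

section MaximumPrinciple

theorem fderiv_fderiv_apply_self_nonpos_of_isLocalMax {E : Type*} [NormedAddCommGroup E]
    [NormedSpace ℝ E] {D : E → ℝ} {z : E} (hD : ContDiffAt ℝ 2 D z) (h : IsLocalMax D z) (v : E) :
    fderiv ℝ (fderiv ℝ D) z v v ≤ 0 := by
  by_contra! hneg
  set f : ℝ → ℝ := fun s => D (z + s • v) with hf
  have hline : ∀ s, HasDerivAt (fun s : ℝ => z + s • v) v s := fun s => by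
    simpa using ((hasDerivAt_id s).smul_const v).const_add z
  have hcont : ContinuousAt (fun s : ℝ => z + s • v) 0 := (hline 0).continuousAt
  have h0 : z + (0 : ℝ) • v = z := by simp
  have hd : ∀ᶠ s in 𝓝 (0 : ℝ), deriv f s = fderiv ℝ D (z + s • v) v := by
    have h1 : ∀ᶠ y in 𝓝 z, DifferentiableAt ℝ D y :=
      (hD.eventually (by simp)).mono fun y hy => hy.differentiableAt two_ne_zero
    rw [← h0] at h1
    filter_upwards [hcont.eventually h1] with s hs
    exact (HasFDerivAt.comp_hasDerivAt (l := D) s hs.hasFDerivAt (hline s)).deriv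
  have hdd : deriv (deriv f) 0 = fderiv ℝ (fderiv ℝ D) z v v := by
    rw [EventuallyEq.deriv_eq hd]
    have h2 : HasFDerivAt (fderiv ℝ D) (fderiv ℝ (fderiv ℝ D) z) (z + (0 : ℝ) • v) := by
      rw [h0]
      exact ((hD.fderiv_right (m := 1) (by norm_num)).differentiableAt one_ne_zero).hasFDerivAt
    have h3 := HasFDerivAt.comp_hasDerivAt (l := fderiv ℝ D) 0 h2 (hline 0)
    simpa using (h3.clm_apply (hasDerivAt_const (0 : ℝ) v)).deriv
  have hmax : IsLocalMax f 0 := by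
    have h1 : ∀ᶠ y in 𝓝 (z + (0 : ℝ) • v), D y ≤ D z := by rwa [h0]
    change ∀ᶠ s in 𝓝 (0 : ℝ), f s ≤ f 0
    filter_upwards [hcont.eventually h1] with s hs
    simpa [hf] using hs
  have hfc : ContinuousAt f 0 :=
    ContinuousAt.comp_of_eq hD.continuousAt hcont h0
  have hmin : IsLocalMin f 0 :=
    isLocalMin_of_deriv_deriv_pos (by rw [hdd]; exact hneg) hmax.deriv_eq_zero hfc
  have hconst : f =ᶠ[𝓝 0] fun _ => f 0 := by
    filter_upwards [hmax, hmin] with s h1 h2 using le_antisymm h1 h2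
  have h4 : deriv f =ᶠ[𝓝 0] fun _ => 0 := by
    simpa using hconst.deriv
  have h5 := h4.deriv_eq
  rw [hdd, deriv_const] at h5
  exact hneg.ne' h5

variable {n : ℕ}

local notation "𝔼" => EuclideanSpace ℝ (Fin n)

/-- At a maximum of `ψ - φ` the gradients agree and the Hessians are ordered. -/
theorem graphTrace_le_of_isLocalMax {S : 𝔼 → 𝔼 →L[ℝ] 𝔼 →L[ℝ] ℝ} {φ ψ : 𝔼 → ℝ} {z β : 𝔼}
    (hsymm : ∀ v w, S z v w = S z w v) (hpos : ∀ v, v ≠ 0 → 0 < S z v v)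
    (hφ : ContDiffAt ℝ 2 φ z) (hψ : ContDiffAt ℝ 2 ψ z)
    (hmax : IsLocalMax (fun y => ψ y - φ y) z) :
    fderiv ℝ ψ z = fderiv ℝ φ z ∧ graphTrace S φ z β ≤ graphTrace S ψ z β := by
  have hφ1 := hφ.differentiableAt two_ne_zero
  have hψ1 := hψ.differentiableAt two_ne_zero
  have hφ2 := (hφ.fderiv_right (m := 1) (by norm_num)).differentiableAt one_ne_zero
  have hψ2 := (hψ.fderiv_right (m := 1) (by norm_num)).differentiableAt one_ne_zero
  have hgrad : fderiv ℝ ψ z = fderiv ℝ φ z := by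
    have := hmax.fderiv_eq_zero
    rwa [fderiv_fun_sub hψ1 hφ1, sub_eq_zero] at this
  refine ⟨hgrad, ?_⟩
  have hess : ∀ v w, fderiv ℝ (fderiv ℝ (fun y => ψ y - φ y)) z v w =
      fderiv ℝ (fderiv ℝ ψ) z v w - fderiv ℝ (fderiv ℝ φ) z v w := by
    intro v w
    have e : fderiv ℝ (fun y => ψ y - φ y) =ᶠ[𝓝 z] fun y => fderiv ℝ ψ y - fderiv ℝ φ y := by
      filter_upwards [hφ.eventually (by simp), hψ.eventually (by simp)] with y h1 h2
      exact fderiv_fun_sub (h2.differentiableAt two_ne_zero) (h1.differentiableAt two_ne_zero)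
    rw [e.fderiv_eq, fderiv_fun_sub hψ2 hφ2]
    rfl
  have hneg := fderiv_fderiv_apply_self_nonpos_of_isLocalMax (hψ.sub hφ) hmax
  have hsφ := hφ.isSymmSndFDerivAt (by simp)
  have hsψ := hψ.isSymmSndFDerivAt (by simp)
  let g : 𝔼 →ₗ[ℝ] 𝔼 →ₗ[ℝ] ℝ := LinearMap.mk₂ ℝ
    (fun v w => S z v w + fderiv ℝ φ z v * fderiv ℝ φ z w)
    (by intros; simp; ring) (by intros; simp; ring) (by intros; simp; ring) (by intros; simp; ring)
  let h (χ : 𝔼 → ℝ) : 𝔼 →ₗ[ℝ] 𝔼 →ₗ[ℝ] ℝ := LinearMap.mk₂ ℝ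
    (fun v w => S z v w + fderiv ℝ φ z v * fderiv ℝ φ z w -
      (fderiv ℝ (fderiv ℝ χ) z v w - christoffelFirst S z v w β))
    (by intros; simp [christoffelFirst]; ring) (by intros; simp [christoffelFirst]; ring)
    (by intros; simp [christoffelFirst]; ring) (by intros; simp [christoffelFirst]; ring)
  have hg : ∀ v w, g v w = S z v w + fderiv ℝ φ z v * fderiv ℝ φ z w := fun _ _ => rfl
  have hh : ∀ χ v w, h χ v w = S z v w + fderiv ℝ φ z v * fderiv ℝ φ z w -
      (fderiv ℝ (fderiv ℝ χ) z v w - christoffelFirst S z v w β) := fun _ _ _ => rfl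
  have key : formTrace (fun v w => g v w) (fun v w => h φ v w) ≤
      formTrace (fun v w => g v w) (fun v w => h ψ v w) := by
    refine formTrace_mono g (h φ) (h ψ) ?_ ?_ ?_ ?_
    · intro v w
      rw [hg, hg, hsymm]; ring
    · intro v hv
      rw [hg]
      exact add_pos_of_pos_of_nonneg (hpos v hv) (mul_self_nonneg _)
    · intro v w
      rw [hh, hh, hh, hh, hsφ.eq v w, hsψ.eq v w]; ring
    · intro v
      have := hneg v
      rw [hess] at this
      rw [hh, hh]
      linarith
  have e1 : graphTrace S ψ z β = formTrace (fun v w => g v w) (fun v w => h ψ v w) := by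
    unfold graphTrace
    rw [hgrad]
    rfl
  rw [e1]
  exact key

variable {M : Type*} [TopologicalSpace M] [ChartedSpace (EuclideanSpace ℝ (Fin n)) M]
  {g : ∀ q : M, TangentSpace (𝓡 n) q →L[ℝ] TangentSpace (𝓡 n) q →L[ℝ] ℝ}
  {φ : ℝ → M → ℝ} {a b : ℝ}

/-- The evolution equation of the logarithmic radius of a graphical solution at time `t` and at
the point `q`: the product of the speed and `graphTrace` is `1 + |dφ|²`. -/
def HasGraphSpeed (g : ∀ q : M, TangentSpace (𝓡 n) q →L[ℝ] TangentSpace (𝓡 n) q →L[ℝ] ℝ)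
    (φ : ℝ → M → ℝ) (t : ℝ) (q : M) : Prop :=
  ContDiffAt ℝ 2 (fun a : ℝ × 𝔼 => φ a.1 ((extChartAt (𝓡 n) q).symm a.2))
      (t, extChartAt (𝓡 n) q q) ∧
    0 < deriv (fun s => φ s q) t ∧
    ∃ β, (∀ v, chartMetric (𝓡 n) g q (extChartAt (𝓡 n) q q) v β =
        fderiv ℝ (fun y => φ t ((extChartAt (𝓡 n) q).symm y)) (extChartAt (𝓡 n) q q) v) ∧
      deriv (fun s => φ s q) t * graphTrace (chartMetric (𝓡 n) g q)
        (fun y => φ t ((extChartAt (𝓡 n) q).symm y)) (extChartAt (𝓡 n) q q) β =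
        1 + fderiv ℝ (fun y => φ t ((extChartAt (𝓡 n) q).symm y)) (extChartAt (𝓡 n) q q) β

/-- Where the difference of two time slices is maximal, the later slice is the slower one. -/
theorem HasGraphSpeed.deriv_le [IsManifold (𝓡 n) ∞ M]
    (hsymm : ∀ q (v w : TangentSpace (𝓡 n) q), g q v w = g q w v)
    (hpos : ∀ q (v : TangentSpace (𝓡 n) q), v ≠ 0 → 0 < g q v v) {t₁ t₂ : ℝ} {q : M}
    (h₁ : HasGraphSpeed g φ t₁ q) (h₂ : HasGraphSpeed g φ t₂ q)
    (hmax : ∀ q', φ t₂ q' - φ t₁ q' ≤ φ t₂ q - φ t₁ q) :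
    deriv (fun s => φ s q) t₂ ≤ deriv (fun s => φ s q) t₁ := by
  obtain ⟨hc₁, hd₁, β₁, hβ₁, he₁⟩ := h₁
  obtain ⟨hc₂, hd₂, β₂, hβ₂, he₂⟩ := h₂
  set z := extChartAt (𝓡 n) q q
  set S := chartMetric (𝓡 n) g q
  have hSz : ∀ v w : 𝔼, S z v w = g q v w := chartMetric_self g q
  have hSpos : ∀ v, v ≠ 0 → 0 < S z v v := fun v hv => by rw [hSz]; exact hpos q v hv
  have hsl : ∀ {t}, ContDiffAt ℝ 2 (fun a : ℝ × 𝔼 => φ a.1 ((extChartAt (𝓡 n) q).symm a.2)) (t, z) →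
      ContDiffAt ℝ 2 (fun y => φ t ((extChartAt (𝓡 n) q).symm y)) z := fun h =>
    ContDiffAt.comp (g := fun a : ℝ × 𝔼 => φ a.1 ((extChartAt (𝓡 n) q).symm a.2)) _ h
      (contDiffAt_const.prodMk contDiffAt_id)
  obtain ⟨hgrad, htr⟩ := graphTrace_le_of_isLocalMax (S := S) (β := β₁)
    (fun v w => by rw [hSz, hSz]; exact hsymm q v w) hSpos (hsl hc₁) (hsl hc₂)
    (Eventually.of_forall fun y => by simpa [z] using hmax _)
  have hβ : β₂ = β₁ := by
    by_contra hne
    have h1 := hSpos (β₂ - β₁) (sub_ne_zero.mpr hne)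
    rw [map_sub (S z (β₂ - β₁)), hβ₂, hβ₁, hgrad, sub_self] at h1
    exact lt_irrefl _ h1
  subst hβ
  rw [hgrad, ← he₁] at he₂
  have hK : 0 ≤ fderiv ℝ (fun y => φ t₁ ((extChartAt (𝓡 n) q).symm y)) z β₂ := by
    rw [← hβ₁]
    by_cases h : β₂ = 0
    · simp [h]
    · exact (hSpos _ h).le
  set T₁ := graphTrace S (fun y => φ t₁ ((extChartAt (𝓡 n) q).symm y)) z β₂
  have hT : 0 < T₁ := by
    refine pos_of_mul_pos_right (a := deriv (fun s => φ s q) t₁) ?_ hd₁.le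
    rw [he₁]
    linarith
  refine le_of_mul_le_mul_right ?_ hT
  rw [← he₂]
  exact mul_le_mul_of_nonneg_left htr hd₂.le

theorem HasGraphSpeed.continuousOn (h : ∀ t ∈ Ioo a b, ∀ q, HasGraphSpeed g φ t q) :
    ContinuousOn (fun z : ℝ × M => φ z.1 z.2) (Ioo a b ×ˢ univ) := fun z hz =>
  (continuousAt_of_chart (n := n) (h z.1 hz.1 z.2).1.continuousAt).continuousWithinAt

theorem HasGraphSpeed.continuousOn_deriv (h : ∀ t ∈ Ioo a b, ∀ q, HasGraphSpeed g φ t q) :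
    ContinuousOn (fun z : ℝ × M => deriv (fun s => φ s z.2) z.1) (Ioo a b ×ˢ univ) := fun z hz =>
  (continuousAt_deriv_time_of_chart (n := n)
    ((h z.1 hz.1 z.2).1.of_le one_le_two)).continuousWithinAt

theorem HasGraphSpeed.differentiableAt {t : ℝ} {q : M} (h : HasGraphSpeed g φ t q) :
    DifferentiableAt ℝ (fun s => φ s q) t :=
  differentiableAt_time_of_chart (n := n) (h.1.of_le one_le_two)

variable [IsManifold (𝓡 n) ∞ M] [CompactSpace M]

/-- The maximum principle for two time translates of a graphical solution: the maximum of their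
difference does not increase. -/
theorem HasGraphSpeed.sub_le_of_sub_le
    (hsymm : ∀ q (v w : TangentSpace (𝓡 n) q), g q v w = g q w v)
    (hpos : ∀ q (v : TangentSpace (𝓡 n) q), v ≠ 0 → 0 < g q v v)
    (h : ∀ t ∈ Ioo a b, ∀ q, HasGraphSpeed g φ t q) {ε τ m : ℝ} (hε : a < ε) (hτ : 0 ≤ τ)
    (hm : ∀ q, φ (ε + τ) q - φ ε q ≤ m) {t : ℝ} (hεt : ε ≤ t) (htb : t + τ < b) (q : M) :
    φ (t + τ) q - φ t q ≤ m := by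
  by_contra! hlt
  have hne : ε ≠ t := by
    rintro rfl
    exact (hm q).not_gt hlt
  have hεt' : 0 < t - ε := sub_pos.mpr (lt_of_le_of_ne hεt hne)
  -- a small slope `δ` in time moves the maximum away from the initial time `ε`
  set δ := (φ (t + τ) q - φ t q - m) / (2 * (t - ε)) with hδdef
  have hδ : 0 < δ := div_pos (by linarith) (by linarith)
  have hδt : δ * (t - ε) = (φ (t + τ) q - φ t q - m) / 2 := by
    rw [hδdef]; field_simp
  set W : ℝ × M → ℝ := fun z => φ (z.1 + τ) z.2 - φ z.1 z.2 - δ * (z.1 - ε) with hW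
  have hmem : ∀ s ∈ Icc ε t, s ∈ Ioo a b ∧ s + τ ∈ Ioo a b := fun s hs =>
    ⟨⟨by linarith [hs.1], by linarith [hs.2]⟩, ⟨by linarith [hs.1], by linarith [hs.2]⟩⟩
  have hWc : ContinuousOn W (Icc ε t ×ˢ univ) := by
    have h1 : ContinuousOn (fun z : ℝ × M => φ z.1 z.2) (Icc ε t ×ˢ univ) :=
      (HasGraphSpeed.continuousOn h).mono fun z hz => ⟨(hmem _ hz.1).1, hz.2⟩
    have h2 : ContinuousOn (fun z : ℝ × M => φ (z.1 + τ) z.2) (Icc ε t ×ˢ univ) :=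
      ContinuousOn.comp (t := Ioo a b ×ˢ univ) (f := fun z : ℝ × M => (z.1 + τ, z.2))
        (HasGraphSpeed.continuousOn h) (by fun_prop) fun z hz => ⟨(hmem _ hz.1).2, mem_univ _⟩
    exact (h2.sub h1).sub (by fun_prop)
  obtain ⟨⟨s, p⟩, ⟨hs, -⟩, hmax⟩ := (isCompact_Icc.prod isCompact_univ).exists_isMaxOn
    ⟨(t, q), right_mem_Icc.mpr hεt, mem_univ _⟩ hWc
  have hsmax : ∀ z ∈ Icc ε t ×ˢ (univ : Set M), W z ≤ W (s, p) := fun z hz => hmax hz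
  have hWm : m < W (s, p) := by
    refine lt_of_lt_of_le ?_ (hsmax (t, q) ⟨right_mem_Icc.mpr hεt, mem_univ _⟩)
    simp only [hW]
    linarith
  have hsε : ε < s := by
    refine lt_of_le_of_ne hs.1 ?_
    rintro rfl
    simp only [hW, sub_self, mul_zero, sub_zero] at hWm
    exact (hm p).not_gt hWm
  have hle : deriv (fun s => φ s p) (s + τ) ≤ deriv (fun s => φ s p) s := by
    refine HasGraphSpeed.deriv_le hsymm hpos (h _ (hmem s hs).1 p) (h _ (hmem s hs).2 p) fun q' =>
      ?_
    have := hsmax (s, q') ⟨hs, mem_univ _⟩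
    simp only [hW] at this
    linarith
  have hd : HasDerivAt (fun s => W (s, p))
      (deriv (fun s => φ s p) (s + τ) - deriv (fun s => φ s p) s - δ) s := by
    have h1 := (h _ (hmem s hs).2 p).differentiableAt.hasDerivAt
    have h2 := (h _ (hmem s hs).1 p).differentiableAt.hasDerivAt
    have h3 : HasDerivAt (fun s => δ * (s - ε)) δ s := by
      simpa using ((hasDerivAt_id s).sub_const ε).const_mul δ
    exact ((h1.comp_add_const s τ).sub h2).sub h3
  have hmaxOn : IsLocalMaxOn (fun s => W (s, p)) (Icc ε s) s := by
    refine IsMaxOn.localize fun s' hs' => ?_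
    exact hsmax (s', p) ⟨⟨hs'.1, hs'.2.trans hs.2⟩, mem_univ _⟩
  have hseg : ε - s ∈ posTangentConeAt (Icc ε s) s := by
    refine sub_mem_posTangentConeAt_of_segment_subset ?_
    rw [segment_symm, segment_eq_Icc hsε.le]
  have := hmaxOn.hasFDerivWithinAt_nonpos hd.hasFDerivAt.hasFDerivWithinAt hseg
  simp only [ContinuousLinearMap.toSpanSingleton_apply, smul_eq_mul] at this
  nlinarith

/-- The speed of a graphical solution is bounded after any positive time. -/
theorem HasGraphSpeed.exists_deriv_le
    (hsymm : ∀ q (v w : TangentSpace (𝓡 n) q), g q v w = g q w v)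
    (hpos : ∀ q (v : TangentSpace (𝓡 n) q), v ≠ 0 → 0 < g q v v)
    (h : ∀ t ∈ Ioo a b, ∀ q, HasGraphSpeed g φ t q) {ε : ℝ} (hε : ε ∈ Ioo a b) :
    ∃ C, ∀ t ∈ Ico ε b, ∀ q, deriv (fun s => φ s q) t ≤ C := by
  obtain ⟨c, hεc, hcb⟩ := exists_between hε.2
  have hsub : Icc ε c ⊆ Ioo a b := fun s hs => ⟨hε.1.trans_le hs.1, hs.2.trans_lt hcb⟩
  obtain ⟨C, hC⟩ := (isCompact_Icc.prod (isCompact_univ (X := M))).bddAbove_image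
    ((HasGraphSpeed.continuousOn_deriv h).mono (prod_mono hsub Subset.rfl))
  have hC' : ∀ s ∈ Icc ε c, ∀ q, deriv (fun s => φ s q) s ≤ C := fun s hs q =>
    hC ⟨(s, q), ⟨hs, mem_univ _⟩, rfl⟩
  refine ⟨C, fun t ht q => ?_⟩
  have htab : t ∈ Ioo a b := ⟨hε.1.trans_le ht.1, ht.2⟩
  have hslope := (hasDerivAt_iff_tendsto_slope_zero.mp
    (h t htab q).differentiableAt.hasDerivAt).mono_left (nhdsGT_le_nhdsNE 0)
  refine le_of_tendsto hslope ?_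
  filter_upwards [Ioo_mem_nhdsGT (sub_pos.mpr hεc), Ioo_mem_nhdsGT (sub_pos.mpr ht.2)]
    with τ hτ hτ'
  rw [smul_eq_mul, inv_mul_le_iff₀ hτ.1]
  refine HasGraphSpeed.sub_le_of_sub_le hsymm hpos h hε.1 hτ.1.le (fun q' => ?_) ht.1
    (by linarith [hτ'.2]) q
  have hsub' : Icc ε (ε + τ) ⊆ Icc ε c := Icc_subset_Icc_right (by linarith [hτ.2])
  have := (convex_Icc ε (ε + τ)).image_sub_le_mul_sub_of_deriv_le (f := fun s => φ s q') (C := C)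
    (fun s hs => (h s (hsub (hsub' hs)) q').differentiableAt.continuousAt.continuousWithinAt)
    (fun s hs => (h s (hsub (hsub' (interior_subset hs)))
      q').differentiableAt.differentiableWithinAt)
    (fun s hs => hC' s (hsub' (interior_subset hs)) q') ε (left_mem_Icc.mpr (by linarith [hτ.1]))
    (ε + τ) (right_mem_Icc.mpr (by linarith [hτ.1])) (by linarith [hτ.1])
  linarith

end MaximumPrinciple

/-! ### The normal stays transversal to the radial slices -/

section Final

variable {n : ℕ} {M : Type*} [TopologicalSpace M] [ChartedSpace (EuclideanSpace ℝ (Fin n)) M]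

local notation "𝔼" => EuclideanSpace ℝ (Fin n)

variable [IsManifold (𝓡 n) ∞ M] {T : EReal} {u₀ : M → ℝ} {x : ℝ → M → ℝ × M}
  {ν : ∀ (t : ℝ) (p : M), TangentSpace (coneModel n) (x t p)}

section

variable {σ : ∀ q : M, TangentSpace (𝓡 n) q →L[ℝ] TangentSpace (𝓡 n) q →L[ℝ] ℝ}

omit [IsManifold (𝓡 n) ∞ M] in
theorem warpedMetric_smul_radialField (a : ℝ × M) (c : ℝ) (v : TangentSpace (coneModel n) a) :
    warpedMetric σ a (c • radialField a) v = c * (tangentCoord v).1 := by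
  have h1 : tangentCoord (c • radialField (n := n) a) = (c, 0) := by
    change c • ((1 : ℝ), (0 : 𝔼)) = (c, 0)
    simp
  rw [warpedMetric_apply, h1]
  have h2 : σ a.2 (0 : TangentSpace (𝓡 n) a.2) (tangentCoord v).2 = 0 := by
    rw [map_zero]; rfl
  change c * (tangentCoord v).1 + a.1 ^ 2 * σ a.2 (0 : TangentSpace (𝓡 n) a.2) (tangentCoord v).2 =
    _
  rw [h2, mul_zero, add_zero]

theorem IsSolution.normal_fst_zero_pos (hx : IsSolution σ T u₀ x ν) (p : M) :
    0 < (tangentCoord (ν 0 p)).1 := by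
  have h := hx.normal_outward p
  have h1 := warpedMetric_smul_radialField (σ := σ) (x 0 p) 1 (ν 0 p)
  rw [one_smul, one_mul] at h1
  rwa [h1] at h

theorem Icc_subset_timeInterval {b : ℝ} (hb : b ∈ timeInterval T) : Icc 0 b ⊆ timeInterval T :=
  fun _ hs => ⟨hs.1, (EReal.coe_le_coe_iff.mpr hs.2).trans_lt hb.2⟩

/-- The mean curvature stays positive as long as the hypersurfaces are graphs: the radius is
differentiable in time, and its derivative has the intermediate value property. -/
theorem IsSolution.meanCurvature_inv_pos (hx : IsSolution σ T u₀ x ν)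
    (hH₀ : ∀ p, 0 < meanCurvature (n := n) (coneModel n) (warpedMetric σ) (x 0) (ν 0) p)
    {t : ℝ} (ht : t ∈ timeInterval T) (p : M)
    (hpos : ∀ s ∈ Icc 0 t, 0 < (tangentCoord (ν s p)).1) :
    0 < (meanCurvature (n := n) (coneModel n) (warpedMetric σ) (x t) (ν t) p)⁻¹ := by
  have hsub := Icc_subset_timeInterval ht
  have h0 : (0 : ℝ) ∈ Icc 0 t := left_mem_Icc.mpr ht.1
  have h1 : t ∈ Icc 0 t := right_mem_Icc.mpr ht.1
  rcases hasDerivWithinAt_forall_lt_or_forall_gt_of_forall_ne (convex_Icc 0 t)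
    (fun s hs => (hx.hasDerivWithinAt_radius (hsub hs) p).mono hsub) (m := 0)
    (fun s hs => mul_ne_zero (inv_ne_zero (hx.meanCurvature_ne_zero s (hsub hs) p))
      (hpos s hs).ne') with h | h
  · exact absurd (h 0 h0) (mul_pos (inv_pos.mpr (hH₀ p)) (hpos 0 h0)).le.not_gt
  · exact pos_of_mul_pos_left (h t h1) (hpos t h1).le

/-- The velocity of the flow, in a fixed chart, for times near `t`. -/
theorem IsSolution.eventually_hasDerivAt_flowChart (hx : IsSolution σ T u₀ x ν) {t : ℝ}
    (ht : t ∈ timeInterval T) (ht0 : 0 < t) (p : M) :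
    ∀ᶠ s in 𝓝 t, HasDerivAt (fun s => flowChart x t p (s, extChartAt (𝓡 n) p p))
      ((meanCurvature (n := n) (coneModel n) (warpedMetric σ) (x s) (ν s) p)⁻¹ •
        (trivializationAt (ℝ × 𝔼) (TangentSpace (coneModel n)) (x t p) ⟨x s p, ν s p⟩).2) s := by
  have : IsManifold (𝓡 n) 1 M := .of_le (n := ∞) (by simp)
  have h1 : ∀ᶠ s in 𝓝 t, s ∈ timeInterval T ∧ 0 < s :=
    Filter.inter_mem (timeInterval_mem_nhds ht ht0) (lt_mem_nhds ht0)
  have hc : ContinuousAt (fun s => x s p) t :=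
    ((hx.flow t ht p).continuousWithinAt).continuousAt (timeInterval_mem_nhds ht ht0)
  have h2 : ∀ᶠ s in 𝓝 t, x s p ∈ (chartAt (ModelProd ℝ 𝔼) (x t p)).source :=
    hc.eventually (chart_source_mem_nhds (ModelProd ℝ 𝔼) (x t p))
  filter_upwards [h1, h2] with s hs hs2
  have h3 := (mdifferentiableAt_extChartAt (I := coneModel n) hs2).hasMFDerivAt.comp s
    ((hx.flow s hs.1 p).hasMFDerivAt (timeInterval_mem_nhds hs.1 hs.2))
  have h4 := HasFDerivAt.hasDerivAt (𝕜 := ℝ) (F := ℝ × 𝔼) (hasMFDerivAt_iff_hasFDerivAt.mp h3)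
  have e : (fun s => flowChart x t p (s, extChartAt (𝓡 n) p p)) =
      extChartAt (coneModel n) (x t p) ∘ fun s => x s p := by
    funext s
    rw [flowChart_eq, extChartAt_to_inv]
    rfl
  rw [e]
  refine h4.congr_deriv ?_
  rw [trivializationAt_apply_snd hs2]
  set D := mfderiv (coneModel n) 𝓘(ℝ, ℝ × 𝔼) (extChartAt (coneModel n) (x t p)) (x s p)
  set H := (meanCurvature (n := n) (coneModel n) (warpedMetric σ) (x s) (ν s) p)⁻¹
  have h5 : D ((1 : ℝ) • (H • ν s p)) = H • D (ν s p) :=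
    (congrArg D (one_smul ℝ (H • ν s p))).trans (map_smul D H (ν s p))
  exact h5

end

variable [T2Space M] [CompactSpace M]

theorem IsSolution.eventually_injective_snd
    {σ : Bundle.ContMDiffRiemannianMetric (𝓡 n) ∞ 𝔼 (fun p : M => TangentSpace (𝓡 n) p)}
    (hx : IsSolution σ.inner T u₀ x ν)
    (hu₀ : ContMDiff (𝓡 n) 𝓘(ℝ, ℝ) 2 u₀) {b : ℝ} (hb : Ico 0 b ⊆ timeInterval T)
    (hpos : ∀ t ∈ Ico 0 b, ∀ p, 0 < (tangentCoord (ν t p)).1) {t : ℝ} (ht : t ∈ Ioo 0 b) :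
    ∀ᶠ s in 𝓝 t, Function.Injective fun p => (x s p).2 := by
  filter_upwards [Ioo_mem_nhds ht.1 ht.2] with s hs
  exact (hx.bijective_snd hu₀ (hb ⟨hs.1.le, hs.2⟩)
    fun s' hs' => hpos s' ⟨hs'.1, hs'.2.trans_lt hs.2⟩).1

/-- Before the time `b` the logarithmic radius satisfies its evolution equation, and its speed is
`(r * ν.1 * H)⁻¹`. -/
theorem IsSolution.hasGraphSpeed
    {σ : Bundle.ContMDiffRiemannianMetric (𝓡 n) ∞ 𝔼 (fun p : M => TangentSpace (𝓡 n) p)}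
    (hx : IsSolution σ.inner T u₀ x ν)
    (hu₀ : ContMDiff (𝓡 n) 𝓘(ℝ, ℝ) 2 u₀)
    (hH₀ : ∀ p, 0 < meanCurvature (n := n) (coneModel n) (warpedMetric σ.inner) (x 0) (ν 0) p)
    {b : ℝ} (hb : Ico 0 b ⊆ timeInterval T)
    (hpos : ∀ t ∈ Ico 0 b, ∀ p, 0 < (tangentCoord (ν t p)).1) {t : ℝ} (ht : t ∈ Ioo 0 b) (p : M) :
    HasGraphSpeed (n := n) σ.inner (logRadius x) t (x t p).2 ∧
      deriv (fun s => logRadius x s (x t p).2) t * ((x t p).1 * (tangentCoord (ν t p)).1) =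
        (meanCurvature (n := n) (coneModel n) (warpedMetric σ.inner) (x t) (ν t) p)⁻¹ := by
  have htb : t ∈ Ico 0 b := ⟨ht.1.le, ht.2⟩
  have hinj := hx.eventually_injective_snd hu₀ hb hpos ht
  have hφ := hx.contDiffAt_logRadius hu₀ (hb htb) ht.1 p (hpos t htb p) hinj
  have hgraph : ∀ᶠ s in 𝓝 t, ∀ p, (x s p).1 = Real.exp (logRadius x s (x s p).2) := by
    filter_upwards [hinj, Ioo_mem_nhds ht.1 ht.2] with s hs hsb p
    exact exp_logRadius hs (hx.radius_pos s (hb ⟨hsb.1.le, hsb.2⟩) p)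
  obtain ⟨β, hβ, h1, h2⟩ := hx.graph_speed (hb htb) ht.1 p (hpos t htb p) rfl hφ hgraph
  refine ⟨⟨hφ, ?_, β, hβ, h1⟩, h2⟩
  have hH := hx.meanCurvature_inv_pos hH₀ (hb htb) p
    fun s hs => hpos s ⟨hs.1, hs.2.trans_lt ht.2⟩ p
  rw [← h2] at hH
  exact pos_of_mul_pos_left hH (mul_pos (hx.radius_pos t (hb htb) p) (hpos t htb p)).le

/-- If the normal were tangent to a radial slice for the first time at `b`, the bound on the speed
of the logarithmic radius would force the velocity of the flow to vanish there. -/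
theorem IsSolution.normal_fst_ne_zero
    {σ : Bundle.ContMDiffRiemannianMetric (𝓡 n) ∞ 𝔼 (fun p : M => TangentSpace (𝓡 n) p)}
    (hx : IsSolution σ.inner T u₀ x ν)
    (hu₀ : ContMDiff (𝓡 n) 𝓘(ℝ, ℝ) 2 u₀)
    (hH₀ : ∀ p, 0 < meanCurvature (n := n) (coneModel n) (warpedMetric σ.inner) (x 0) (ν 0) p)
    {b : ℝ} (hb0 : 0 < b) (hb : b ∈ timeInterval T)
    (hpos : ∀ t ∈ Ico 0 b, ∀ p, 0 < (tangentCoord (ν t p)).1) (p : M) :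
    (tangentCoord (ν b p)).1 ≠ 0 := by
  intro hzero
  have : IsManifold (𝓡 n) 1 M := .of_le (n := ∞) (by simp)
  have hsub : Ico 0 b ⊆ timeInterval T := Ico_subset_Icc_self.trans (Icc_subset_timeInterval hb)
  have hJ := timeInterval_mem_nhds hb hb0
  have hbij : ∀ t ∈ Ico 0 b, Function.Bijective fun p => (x t p).2 := fun t ht =>
    hx.bijective_snd hu₀ (hsub ht) fun s hs => hpos s ⟨hs.1, hs.2.trans_lt ht.2⟩
  obtain ⟨C, hC⟩ := HasGraphSpeed.exists_deriv_le (g := σ.inner) (φ := logRadius x)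
    (a := 0) (b := b) (ε := b / 2) (fun q v w => σ.symm q v w) (fun q v hv => σ.pos q v hv)
    (fun t ht q => by
      obtain ⟨p, rfl⟩ := (hbij t ⟨ht.1.le, ht.2⟩).2 q
      exact (hx.hasGraphSpeed hu₀ hH₀ hsub hpos ht p).1) ⟨by linarith, by linarith⟩
  set Hinv : ℝ → ℝ := fun t =>
    (meanCurvature (n := n) (coneModel n) (warpedMetric σ.inner) (x t) (ν t) p)⁻¹ with hHinv
  set w : ℝ → ℝ × 𝔼 := fun t =>
    (trivializationAt (ℝ × 𝔼) (TangentSpace (coneModel n)) (x b p) ⟨x t p, ν t p⟩).2 with hw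
  have hxc : ContinuousAt (fun t => x t p) b :=
    ((hx.flow b hb p).continuousWithinAt).continuousAt hJ
  have hpair : ContinuousWithinAt (fun t : ℝ => (t, p)) (timeInterval T) b := by fun_prop
  have hmaps : MapsTo (fun t : ℝ => (t, p)) (timeInterval T) (timeInterval T ×ˢ univ) :=
    fun t ht => ⟨ht, mem_univ _⟩
  have hcc : ContinuousAt (fun t => (tangentCoord (ν t p)).1) b :=
    ((hx.continuousOn_normal_fst (b, p) ⟨hb, mem_univ _⟩).comp (f := fun t : ℝ => (t, p)) hpair
      hmaps).continuousAt hJ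
  have hνc : ContinuousAt (fun t => (⟨x t p, ν t p⟩ : TangentBundle (coneModel n) (ℝ × M))) b :=
    ((hx.normal_continuous (b, p) ⟨hb, mem_univ _⟩).comp (f := fun t : ℝ => (t, p)) hpair
      hmaps).continuousAt hJ
  have hwc : ContinuousAt w b := by
    refine continuous_snd.continuousAt.comp (ContinuousAt.comp ?_ hνc)
    set e := trivializationAt (ℝ × 𝔼) (TangentSpace (coneModel n)) (x b p)
    refine e.continuousOn.continuousAt (e.open_source.mem_nhds ?_)
    rw [e.mem_source]
    exact FiberBundle.mem_baseSet_trivializationAt' _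
  have hHpos : ∀ t ∈ Ico 0 b, 0 < Hinv t := fun t ht =>
    hx.meanCurvature_inv_pos hH₀ (hsub ht) p fun s hs => hpos s ⟨hs.1, hs.2.trans_lt ht.2⟩ p
  have hHle : ∀ t ∈ Ico (b / 2) b, Hinv t ≤ C * ((x t p).1 * (tangentCoord (ν t p)).1) := by
    intro t ht
    have ht' : t ∈ Ioo 0 b := ⟨by linarith [ht.1], ht.2⟩
    have ht'' : t ∈ Ico 0 b := ⟨ht'.1.le, ht'.2⟩
    rw [hHinv]
    simp only
    rw [← (hx.hasGraphSpeed hu₀ hH₀ hsub hpos ht' p).2]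
    exact mul_le_mul_of_nonneg_right (hC t ht _)
      (mul_pos (hx.radius_pos t (hsub ht'') p) (hpos t ht'' p)).le
  have hev : ∀ᶠ t in 𝓝[<] b, t ∈ Ico (b / 2) b := Ico_mem_nhdsLT (by linarith)
  -- the velocity tends to zero as `t` increases to `b`
  have hHlim : Tendsto Hinv (𝓝[<] b) (𝓝 0) := by
    have h1 : Tendsto (fun t => C * ((x t p).1 * (tangentCoord (ν t p)).1)) (𝓝[<] b) (𝓝 0) := by
      have h2 : ContinuousAt (fun t => C * ((x t p).1 * (tangentCoord (ν t p)).1)) b :=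
        continuousAt_const.mul ((continuous_fst.continuousAt.comp hxc).mul hcc)
      have h3 := h2.tendsto
      rw [hzero, mul_zero, mul_zero] at h3
      exact h3.mono_left nhdsWithin_le_nhds
    refine squeeze_zero' ?_ ?_ h1
    · filter_upwards [hev] with t ht
      exact (hHpos t ⟨by linarith [ht.1], ht.2⟩).le
    · filter_upwards [hev] with t ht using hHle t ht
  have hlim : Tendsto (fun t => Hinv t • w t) (𝓝[<] b) (𝓝 0) := by
    have := hHlim.smul (hwc.tendsto.mono_left nhdsWithin_le_nhds)
    rwa [zero_smul] at this
  -- by smoothness it is continuous at `b`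
  have hder := hx.eventually_hasDerivAt_flowChart hb hb0 p
  have hcont : ContinuousAt (deriv fun s => flowChart x b p (s, extChartAt (𝓡 n) p p)) b := by
    have h1 : ContDiffAt ℝ 1 (fun s => flowChart x b p (s, extChartAt (𝓡 n) p p)) b :=
      ContDiffAt.comp (g := flowChart x b p) b
        ((hx.contDiffAt_flowChart hb hb0 p).of_le (by norm_cast))
        (contDiffAt_id.prodMk contDiffAt_const)
    exact (h1.fderiv_right (m := 0) (by norm_num)).continuousAt.clm_apply
      (continuousAt_const (y := (1 : ℝ)))
  have hlim2 : Tendsto (fun t => Hinv t • w t) (𝓝[<] b)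
      (𝓝 (deriv (fun s => flowChart x b p (s, extChartAt (𝓡 n) p p)) b)) := by
    refine (hcont.tendsto.mono_left nhdsWithin_le_nhds).congr' ?_
    filter_upwards [hder.filter_mono nhdsWithin_le_nhds] with t ht using ht.deriv
  have hzero' := tendsto_nhds_unique hlim2 hlim
  rw [((hx.hasDerivWithinAt_flowChart hb p).hasDerivAt hJ).deriv] at hzero'
  have hν0 : tangentCoord (ν b p) = 0 :=
    (smul_eq_zero.mp hzero').resolve_left (inv_ne_zero (hx.meanCurvature_ne_zero b hb p))
  have hunit := hx.normal_unit b hb p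
  have h0 : ν b p = 0 := hν0
  rw [h0, map_zero] at hunit
  exact zero_ne_one hunit

/-- The radial component of the normal is positive at all times. -/
theorem IsSolution.normal_fst_pos
    {σ : Bundle.ContMDiffRiemannianMetric (𝓡 n) ∞ 𝔼 (fun p : M => TangentSpace (𝓡 n) p)}
    (hx : IsSolution σ.inner T u₀ x ν)
    (hu₀ : ContMDiff (𝓡 n) 𝓘(ℝ, ℝ) 2 u₀)
    (hH₀ : ∀ p, 0 < meanCurvature (n := n) (coneModel n) (warpedMetric σ.inner) (x 0) (ν 0) p)
    {t : ℝ} (ht : t ∈ timeInterval T) (p : M) : 0 < (tangentCoord (ν t p)).1 := by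
  by_contra! hneg
  have hsub := Icc_subset_timeInterval ht
  have hcont := hx.continuousOn_normal_fst.mono (prod_mono hsub (Subset.refl (univ : Set M)))
  have hK : IsCompact ((Icc 0 t ×ˢ (univ : Set M)) ∩
      (fun z : ℝ × M => (tangentCoord (ν z.1 z.2)).1) ⁻¹' Iic 0) :=
    (isCompact_Icc.prod isCompact_univ).of_isClosed_subset
      (hcont.preimage_isClosed_of_isClosed (isClosed_Icc.prod isClosed_univ) isClosed_Iic)
      inter_subset_left
  obtain ⟨⟨b, q⟩, ⟨⟨hbt, -⟩, hbq⟩, hmin⟩ := hK.exists_isMinOn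
    ⟨(t, p), ⟨right_mem_Icc.mpr ht.1, mem_univ _⟩, hneg⟩ continuous_fst.continuousOn
  have hbq' : (tangentCoord (ν b q)).1 ≤ 0 := hbq
  have hpos : ∀ s ∈ Ico 0 b, ∀ p, 0 < (tangentCoord (ν s p)).1 := by
    intro s hs p
    by_contra! h
    have : b ≤ s := hmin (a := (s, p)) ⟨⟨⟨hs.1, hs.2.le.trans hbt.2⟩, mem_univ _⟩, h⟩
    exact hs.2.not_ge this
  have hb0 : 0 < b := by
    refine lt_of_le_of_ne hbt.1 ?_
    rintro rfl
    exact (hx.normal_fst_zero_pos q).not_ge hbq'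
  refine hx.normal_fst_ne_zero hu₀ hH₀ hb0 (hsub hbt) hpos q (le_antisymm hbq' ?_)
  have hJ := timeInterval_mem_nhds (hsub hbt) hb0
  have hcc : ContinuousAt (fun t => (tangentCoord (ν t q)).1) b :=
    ContinuousWithinAt.continuousAt
      ((hx.continuousOn_normal_fst (b, q) ⟨hsub hbt, mem_univ _⟩).comp (f := fun t : ℝ => (t, q))
        (by fun_prop) fun t ht => ⟨ht, mem_univ _⟩) hJ
  refine ge_of_tendsto (hcc.tendsto.mono_left (nhdsWithin_le_nhds (s := Iio b))) ?_
  filter_upwards [Ico_mem_nhdsLT hb0] with s hs using (hpos s hs q).le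

theorem IsSolution.exists_graph
    {σ : Bundle.ContMDiffRiemannianMetric (𝓡 n) ∞ 𝔼 (fun p : M => TangentSpace (𝓡 n) p)}
    (hx : IsSolution σ.inner T u₀ x ν)
    (hu₀_pos : ∀ p, 0 < u₀ p) (hu₀ : ContMDiff (𝓡 n) 𝓘(ℝ, ℝ) 2 u₀)
    (hpos : ∀ t ∈ timeInterval T, ∀ p, 0 < (tangentCoord (ν t p)).1) {t : ℝ}
    (ht : t ∈ timeInterval T) :
    ∃ u : M → ℝ, (∀ p, 0 < u p) ∧ ContMDiff (𝓡 n) 𝓘(ℝ, ℝ) 2 u ∧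
      range (x t) = range (fun p => (u p, p)) := by
  rcases ht.1.eq_or_lt with rfl | ht0
  · exact ⟨u₀, hu₀_pos, hu₀, congrArg range (funext hx.initial)⟩
  have hbij : ∀ s ∈ timeInterval T, Function.Bijective fun p => (x s p).2 := fun s hs =>
    hx.bijective_snd hu₀ hs fun s' hs' => hpos s' (Icc_subset_timeInterval hs hs')
  have hgraph : ∀ p, (Real.exp (logRadius x t (x t p).2), (x t p).2) = x t p := fun p =>
    Prod.ext (exp_logRadius (hbij t ht).1 (hx.radius_pos t ht p)).symm rfl
  refine ⟨fun q => Real.exp (logRadius x t q), fun q => Real.exp_pos _, fun q => ?_, ?_⟩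
  · obtain ⟨p, rfl⟩ := (hbij t ht).2 q
    have hinj : ∀ᶠ s in 𝓝 t, Function.Injective fun p => (x s p).2 :=
      mem_of_superset (timeInterval_mem_nhds ht ht0) fun s hs => (hbij s hs).1
    have h1 := contMDiffAt_slice (hx.contDiffAt_logRadius hu₀ ht ht0 p (hpos t ht p) hinj)
    exact (Real.contDiff_exp.contDiffAt.contMDiffAt).comp _ h1
  · refine Subset.antisymm ?_ ?_
    · rintro _ ⟨p, rfl⟩
      exact ⟨(x t p).2, hgraph p⟩
    · rintro _ ⟨q, rfl⟩
      obtain ⟨p, rfl⟩ := (hbij t ht).2 q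
      exact ⟨p, (hgraph p).symm⟩

omit [T2Space M] in
theorem IsSolution.exists_chi_le
    {σ : Bundle.ContMDiffRiemannianMetric (𝓡 n) ∞ 𝔼 (fun p : M => TangentSpace (𝓡 n) p)}
    (hx : IsSolution σ.inner T u₀ x ν)
    (hpos : ∀ t ∈ timeInterval T, ∀ p, 0 < (tangentCoord (ν t p)).1) {t : ℝ}
    (ht : t ∈ timeInterval T) :
    ∃ C : ℝ, ∀ s ∈ Icc 0 t, ∀ p,
      0 < chi σ.inner (x s p) (ν s p) ∧ chi σ.inner (x s p) (ν s p) ≤ C := by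
  have hsub := Icc_subset_timeInterval ht
  have hchi : ∀ z : ℝ × M, chi σ.inner (x z.1 z.2) (ν z.1 z.2) =
      ((x z.1 z.2).1 * (tangentCoord (ν z.1 z.2)).1)⁻¹ := fun z => by
    rw [chi, warpedMetric_smul_radialField]
  have hp : ∀ z ∈ Icc 0 t ×ˢ (univ : Set M),
      0 < (x z.1 z.2).1 * (tangentCoord (ν z.1 z.2)).1 := fun z hz =>
    mul_pos (hx.radius_pos _ (hsub hz.1) _) (hpos _ (hsub hz.1) _)
  have hc : ContinuousOn (fun z : ℝ × M => ((x z.1 z.2).1 * (tangentCoord (ν z.1 z.2)).1)⁻¹)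
      (Icc 0 t ×ˢ (univ : Set M)) :=
    ContinuousOn.inv₀ (((continuous_fst.comp_continuousOn hx.continuousOn).mul
      hx.continuousOn_normal_fst).mono (prod_mono hsub Subset.rfl)) fun z hz => (hp z hz).ne'
  obtain ⟨C, hC⟩ := (isCompact_Icc.prod (isCompact_univ (X := M))).bddAbove_image hc
  refine ⟨C, fun s hs p => ?_⟩
  have hz : (s, p) ∈ Icc 0 t ×ˢ (univ : Set M) := ⟨hs, mem_univ _⟩
  rw [hchi (s, p)]
  exact ⟨inv_pos.mpr (hp _ hz), hC ⟨(s, p), hz, rfl⟩⟩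

end Final

end IMCF

end

theorem mainTheorem4 {n : ℕ} {M : Type*} [TopologicalSpace M] [T2Space M] [CompactSpace M]
    [ChartedSpace (EuclideanSpace ℝ (Fin n)) M] [IsManifold (𝓡 n) ∞ M]
    (σ : Bundle.ContMDiffRiemannianMetric (𝓡 n) ∞ (EuclideanSpace ℝ (Fin n))
      (fun p : M => TangentSpace (𝓡 n) p))
    (hRic : ∀ (p : M) (v : TangentSpace (𝓡 n) p), v ≠ 0 → 0 < IMCF.ricciForm σ.inner p v)
    (u₀ : M → ℝ) (hu₀_pos : ∀ p, 0 < u₀ p) (hu₀ : ContMDiff (𝓡 n) 𝓘(ℝ, ℝ) 2 u₀)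
    (T : EReal) (hT : 0 < T) (x : ℝ → M → ℝ × M)
    (ν : ∀ (t : ℝ) (p : M), TangentSpace (IMCF.coneModel n) (x t p))
    (hx : IMCF.IsSolution σ.inner T u₀ x ν)
    (hH₀ : ∀ p, 0 < IMCF.meanCurvature (n := n) (IMCF.coneModel n) (IMCF.warpedMetric σ.inner)
      (x 0) (ν 0) p) :
    (∀ t ∈ IMCF.timeInterval T, ∃ u : M → ℝ, (∀ p, 0 < u p) ∧ ContMDiff (𝓡 n) 𝓘(ℝ, ℝ) 2 u ∧
      range (x t) = range (fun p => (u p, p))) ∧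
    (∀ T' ∈ IMCF.timeInterval T, ∃ C : ℝ, ∀ t ∈ Icc 0 T', ∀ p,
      0 < IMCF.chi σ.inner (x t p) (ν t p) ∧ IMCF.chi σ.inner (x t p) (ν t p) ≤ C) := by
  have hpos : ∀ t ∈ IMCF.timeInterval T, ∀ p, 0 < (IMCF.tangentCoord (ν t p)).1 :=
    fun t ht p => hx.normal_fst_pos hu₀ hH₀ ht p
  exact ⟨fun t ht => hx.exists_graph hu₀_pos hu₀ hpos ht, fun t ht => hx.exists_chi_le hpos ht⟩
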